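/- Let $n\ge 1$, $\delta>0$, $\sigma\in\mathbb R$, and $\mathbf T^n=(\mathbb R/2\pi\mathbb Z)^n$. For $q\in\mathbb R$ let $H^q(\mathbf T^n)$ be the space of periodic distributions $g=\sum_{k\in\mathbb Z^n}\hat g_k e^{ik\cdot x}$ with finite norm $\|g\|_{H^q}=\big(\sum_{k}(1+\|k\|^2)^q|\hat g_k|^2\big)^{1/2}$. For $\beta<n+4$ let $L^{\delta,\beta}$ be the (extended) nonlocal Laplacian, i.e. the operator on periodic distributions with Fourier multipliers $$m^{\delta,\beta}(k)=-\|k\|^2\,{}_2F_3\Big(1,\tfrac{n+2-\beta}{2};\,2,\tfrac{n+2}{2},\tfrac{n+4-\beta}{2};\,-\tfrac14\|k\|^2\delta^2\Big),\qquad k\in\mathbb Z^n,$$ so that $\widehat{(L^{\delta,\beta}u)}_k=m^{\delta,\beta}(k)\,\hat u_k$. Let $b\in H^\sigma(\mathbf T^n)$. A solution of the nonlocal forced wave equation is a map $U:[0,\infty)\to H^q(\mathbf T^n)$, for some $q\in\mathbb R$, that is twice differentiable on $[0,\infty)$ (derivatives being limits of difference quotients in the norm of $H^q(\mathbf T^n)$,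 one-sided at $t=0$) and satisfies $$U''(t)=L^{\delta,\beta}U(t)+b\quad(t>0),\qquad U(0)=0,\quad U'(0)=0;$$ a solution of the classical forced wave equation is defined in the same way with the Laplacian $\Delta$ in place of $L^{\delta,\beta}$. **Theorem.** For every $\beta<n+4$ the nonlocal equation has a solution, and so does the classical equation, with $q=\sigma$. Let $U^{\delta,\beta}$ (for each $\beta<n+4$) and $U$ be solutions of the nonlocal and the classical equation respectively, each in some Sobolev space. Then for every $t\ge 0$ we have $U^{\delta,\beta}(t)\in H^{s}(\mathbf T^n)$ with $s=\sigma+\max\{0,\beta-n\}$, and $U(t)\in H^{\sigma+2}(\mathbf T^n)$. Moreover, for every $t\ge 0$ and every $\varepsilon\in(0,2)$ with $\varepsilon<n/2$, $$\lim_{\beta\to n+2}U^{\delta,\beta}(t)=U(t)\quad\text{in } H^{s_0}(\mathbf T^n),\qquad s_0=\sigma+2-\varepsilon;$$ that is, $U(t)$ and, for all $\beta\ne n+2$ close enough to $n+2$, $U^{\delta,\beta}(t)$ lie in $H^{s_0}(\mathbf T^n)$, and $\|U^{\delta,\beta}(t)-U(t)\|_{H^{s_0}}\to 0$ as $\beta\to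 n+2$. -/

import Mathlib

open scoped Topology ContDiff

noncomputable section

/-- The lattice point `k ∈ ℤⁿ` as a vector of Euclidean space `ℝⁿ`. -/
def latticeVec {n : ℕ} (k : Fin n → ℤ) : EuclideanSpace ℝ (Fin n) :=
  WithLp.toLp 2 (fun i => (k i : ℝ))

/-- Smooth functions on the torus `𝐓ⁿ = (ℝ / 2πℤ)ⁿ`: smooth functions `ℝⁿ → ℂ` that are
`2π`-periodic in every coordinate. -/
def PeriodicTestFunction (n : ℕ) : Submodule ℂ (EuclideanSpace ℝ (Fin n) → ℂ) where
  carrier := {φ | ContDiff ℝ ∞ φ ∧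
    ∀ (l : Fin n → ℤ) (x : EuclideanSpace ℝ (Fin n)),
      φ (x + (2 * Real.pi) • latticeVec l) = φ x}
  zero_mem' := ⟨contDiff_const, fun _ _ => rfl⟩
  add_mem' := fun {φ ψ} hφ hψ => ⟨hφ.1.add hψ.1, fun l x => by
    simp only [Pi.add_apply, hφ.2 l x, hψ.2 l x]⟩
  smul_mem' := fun c φ hφ => ⟨contDiff_const.smul hφ.1, fun l x => by
    simp only [Pi.smul_apply, hφ.2 l x]⟩

/-- Periodic distributions on `𝐓ⁿ`: linear functionals `u` on the smooth periodic functions that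
are continuous for the topology of uniform convergence of all derivatives, that is,
`|u φ| ≤ C ‖φ‖_{C^N}` for some `C` and `N`. -/
def PeriodicDistribution (n : ℕ) : Submodule ℂ (Module.Dual ℂ (PeriodicTestFunction n)) where
  carrier := {u | ∃ (C : ℝ) (N : ℕ), ∀ (φ : PeriodicTestFunction n) (M : ℝ),
    (∀ j ≤ N, ∀ x, ‖iteratedFDeriv ℝ j (φ : EuclideanSpace ℝ (Fin n) → ℂ) x‖ ≤ M) →
      ‖u φ‖ ≤ C * M}
  zero_mem' := ⟨0, 0, fun φ M _ => by simp⟩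
  add_mem' := by
    rintro u v ⟨C, N, hu⟩ ⟨C', N', hv⟩
    refine ⟨C + C', max N N', fun φ M hM => ?_⟩
    have h1 := hu φ M (fun j hj x => hM j (hj.trans (le_max_left _ _)) x)
    have h2 := hv φ M (fun j hj x => hM j (hj.trans (le_max_right _ _)) x)
    rw [LinearMap.add_apply, add_mul]
    exact (norm_add_le _ _).trans (add_le_add h1 h2)
  smul_mem' := by
    rintro c u ⟨C, N, hu⟩
    refine ⟨‖c‖ * C, N, fun φ M hM => ?_⟩
    rw [LinearMap.smul_apply, norm_smul, mul_assoc]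
    exact mul_le_mul_of_nonneg_left (hu φ M hM) (norm_nonneg c)

/-- The Fourier mode `x ↦ e^{i k·x}` as a test function. -/
def fourierMode {n : ℕ} (k : Fin n → ℤ) : PeriodicTestFunction n :=
  ⟨fun x => Complex.exp (((inner ℝ (latticeVec k) x : ℝ) : ℂ) * Complex.I), by
    constructor
    · have h : ContDiff ℝ ∞ (fun x : EuclideanSpace ℝ (Fin n) =>
          ((inner ℝ (latticeVec k) x : ℝ) : ℂ)) :=
        Complex.ofRealCLM.contDiff.comp (contDiff_const.inner ℝ contDiff_id)
      exact (h.mul contDiff_const).cexp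
    · intro l x
      have h : inner ℝ (latticeVec k) (latticeVec l) = ((∑ i, k i * l i : ℤ) : ℝ) := by
        simp [latticeVec, PiLp.inner_apply, mul_comm]
      rw [Complex.exp_eq_exp_iff_exists_int]
      refine ⟨∑ i, k i * l i, ?_⟩
      rw [inner_add_right, inner_smul_right, h]
      push_cast
      ring⟩

/-- The `k`-th Fourier coefficient `û_k = (2π)⁻ⁿ ⟨u, e^{-i k·x}⟩`, so that `u = ∑ û_k e^{i k·x}`. -/
def fourierCoeffDist {n : ℕ} (u : PeriodicDistribution n) (k : Fin n → ℤ) : ℂ :=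
  ((2 * Real.pi) ^ n : ℂ)⁻¹ * u.1 (fourierMode (-k))

/-- `u ∈ H^q(𝐓ⁿ)`: the sum `∑_k (1 + ‖k‖²)^q |û_k|²` is finite. -/
def MemSobolev {n : ℕ} (q : ℝ) (u : PeriodicDistribution n) : Prop :=
  Summable fun k : Fin n → ℤ => (1 + ‖latticeVec k‖ ^ 2) ^ q * ‖fourierCoeffDist u k‖ ^ 2

/-- The norm of `H^q(𝐓ⁿ)` (meaningful on the elements of `H^q(𝐓ⁿ)`). -/
def sobolevNorm {n : ℕ} (q : ℝ) (u : PeriodicDistribution n) : ℝ :=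
  Real.sqrt (∑' k : Fin n → ℤ, (1 + ‖latticeVec k‖ ^ 2) ^ q * ‖fourierCoeffDist u k‖ ^ 2)

/-- `V` is the time derivative on `[0, ∞)` of the map `U : [0, ∞) → H^q(𝐓ⁿ)`, the limit of
difference quotients being taken in the norm of `H^q(𝐓ⁿ)` (one-sided at `t = 0`). Values at
negative times are ignored. -/
def IsTimeDeriv {n : ℕ} (q : ℝ) (U V : ℝ → PeriodicDistribution n) : Prop :=
  (∀ t, 0 ≤ t → MemSobolev q (U t)) ∧ (∀ t, 0 ≤ t → MemSobolev q (V t)) ∧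
  ∀ t, 0 ≤ t → Filter.Tendsto
    (fun h : ℝ => sobolevNorm q (((h : ℂ)⁻¹) • (U (t + h) - U t) - V t))
    (𝓝[{h : ℝ | h ≠ 0 ∧ 0 ≤ t + h}] 0) (𝓝 0)

/-- The generalized hypergeometric function `₂F₃(a₁, a₂; b₁, b₂, b₃; z)`. -/
def hypergeometric2F3 (a₁ a₂ b₁ b₂ b₃ z : ℝ) : ℝ :=
  ∑' j : ℕ, ((ascPochhammer ℝ j).eval a₁ * (ascPochhammer ℝ j).eval a₂) /
    ((ascPochhammer ℝ j).eval b₁ * (ascPochhammer ℝ j).eval b₂ * (ascPochhammer ℝ j).eval b₃) *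
      (z ^ j / (j.factorial : ℝ))

/-- The Fourier multiplier `m^{δ,β}(ν)` of the (extended) nonlocal Laplacian `L^{δ,β}`. -/
def nonlocalMultiplier {n : ℕ} (δ β : ℝ) (ν : EuclideanSpace ℝ (Fin n)) : ℝ :=
  -‖ν‖ ^ 2 * hypergeometric2F3 1 (((n : ℝ) + 2 - β) / 2) 2 (((n : ℝ) + 2) / 2)
    (((n : ℝ) + 4 - β) / 2) (-(1 / 4) * ‖ν‖ ^ 2 * δ ^ 2)

/-- `w = L^{δ,β} u` in the sense of periodic distributions: `w = ∑ m^{δ,β}(k) û_k e^{i k·x}`. -/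
def IsNonlocalLaplacian {n : ℕ} (δ β : ℝ) (u w : PeriodicDistribution n) : Prop :=
  ∀ k : Fin n → ℤ,
    fourierCoeffDist w k = (nonlocalMultiplier δ β (latticeVec k) : ℂ) * fourierCoeffDist u k

/-- `w = Δ u` in the sense of periodic distributions: `⟨w, φ⟩ = ⟨u, Δφ⟩` for all test functions
`φ` (the test function `ψ` below is `Δφ`). -/
def IsClassicalLaplacian {n : ℕ} (u w : PeriodicDistribution n) : Prop :=
  ∀ φ ψ : PeriodicTestFunction n,
    (ψ : EuclideanSpace ℝ (Fin n) → ℂ) =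
      Laplacian.laplacian (φ : EuclideanSpace ℝ (Fin n) → ℂ) →
    w.1 φ = u.1 ψ

/-- `U : [0, ∞) → H^q(𝐓ⁿ)` is twice differentiable and solves the forced wave equation
`U'' = A U + b` for `t > 0`, `U(0) = 0`, `U'(0) = 0`; the operator `A` is given by its graph,
`A u w` meaning `w = A u`. -/
def SolvesForcedWave {n : ℕ} (A : PeriodicDistribution n → PeriodicDistribution n → Prop)
    (q : ℝ) (b : PeriodicDistribution n) (U : ℝ → PeriodicDistribution n) : Prop :=
  ∃ V W : ℝ → PeriodicDistribution n,
    IsTimeDeriv q U V ∧ IsTimeDeriv q V W ∧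
    (∀ t, 0 < t → ∃ w, A (U t) w ∧ W t = w + b) ∧
    U 0 = 0 ∧ V 0 = 0

end

/-! All operators are diagonal on Fourier modes, so the equation splits into oscillators `u'' = -λ u
+ b̂_k` with zero data, solved only by `w(λ, t) b̂_k` with `w = (1 - cos (√λ t)) / λ`
(`waveKernel`). Classically `λ = ‖k‖²`; in the nonlocal case `λ = ‖k‖² S(δ²‖k‖²/4)` with `S(x) =
₂F₃(1, a; 2, c+1, a+1; -x)`, `c = n/2`, `a = (n+2-β)/2` (`nonlocalSymbol`). Thus `β < n+4` means `a
> -1`, and `β = n+2` means `a = 0`, where `S = 1`. Since `0 ≤ w ≤ min (t²/2) (2/λ)`, regularity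
follows from lower bounds on `λ`, and convergence from dominated convergence over `k` once such a
bound is uniform in `β` near `n+2`.

The bounds on `S` avoid asymptotic expansions. Because `(a)ⱼ/(a+1)ⱼ = a/(a+j)` for `j ≥ 1`, one has
`x S' + a S = a K` with `K = ₁F₂(1; 2, c+1; -x)`, that is `(xᵃ (S - d))' = a xᵃ⁻¹ (K - d)` for every
constant `d`. Moreover `x K = c (1 - B)` with the Bessel-type function `B = ₀F₁(; c; -x)`, whose
energy `B² + x B'²` decreases when `c ≥ 1/2`. Hence `0 ≤ K ≤ 1`, so `xᵃ S` increases for `a > 0` and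
`xᵃ (S - 1)` for `a < 0`. This gives `S > 0` and `S ≥ C x⁻ᵃ` for `x ≥ 1`, so `λ` grows at least like
`‖k‖^(β-n)`.

Existence also requires realizing a coefficient sequence of polynomial growth as a distribution,
which rests on the rapid decay of Fourier coefficients of test functions. Uniqueness is checked
coefficientwise, so the Sobolev space containing the solution plays no role. -/

noncomputable section

/-! ### Power series with factorially decaying coefficients -/

/-- The power series `∑ pⱼ xʲ`. -/
def powerSum (p : ℕ → ℝ) (x : ℝ) : ℝ := ∑' j, p j * x ^ j

/-- Coefficients bounded by a multiple of `1 / j!`. -/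
def FactorialDecay (p : ℕ → ℝ) : Prop := ∃ C : ℝ, ∀ j, |p j| ≤ C / j.factorial

/-- The coefficients of the derivative of a power series. -/
def derivCoeff (p : ℕ → ℝ) (j : ℕ) : ℝ := (j + 1) * p (j + 1)

theorem FactorialDecay.summable {p : ℕ → ℝ} (hp : FactorialDecay p) (x : ℝ) :
    Summable fun j => p j * x ^ j := by
  obtain ⟨C, hC⟩ := hp
  refine Summable.of_norm_bounded ((Real.summable_pow_div_factorial |x|).mul_left C) fun j => ?_
  rw [Real.norm_eq_abs, abs_mul, abs_pow]
  calc |p j| * |x| ^ j ≤ C / j.factorial * |x| ^ j := by gcongr; exact hC j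
    _ = _ := by ring

theorem FactorialDecay.deriv {p : ℕ → ℝ} (hp : FactorialDecay p) :
    FactorialDecay (derivCoeff p) := by
  obtain ⟨C, hC⟩ := hp
  refine ⟨C, fun j => ?_⟩
  have h := hC (j + 1)
  rw [Nat.factorial_succ, Nat.cast_mul] at h
  have hj : (0 : ℝ) < j + 1 := by positivity
  rw [derivCoeff, abs_mul, abs_of_pos hj]
  calc ((j : ℝ) + 1) * |p (j + 1)| ≤ (j + 1) * (C / (((j + 1 : ℕ) : ℝ) * j.factorial)) := by gcongr
    _ = _ := by push_cast; field_simp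

theorem FactorialDecay.mul_bounded {p r : ℕ → ℝ} (hp : FactorialDecay p) {M : ℝ}
    (hr : ∀ j, |r j| ≤ M) : FactorialDecay fun j => r j * p j := by
  obtain ⟨C, hC⟩ := hp
  refine ⟨M * C, fun j => ?_⟩
  rw [abs_mul, mul_div_assoc]
  exact mul_le_mul (hr j) (hC j) (abs_nonneg _) ((abs_nonneg _).trans (hr 0))

theorem powerSum_zero (p : ℕ → ℝ) : powerSum p 0 = p 0 := by
  rw [powerSum, tsum_eq_single 0]
  · simp
  · intro j hj; simp [hj]

theorem powerSum_eq_add_mul {p : ℕ → ℝ} (hp : FactorialDecay p) (x : ℝ) :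
    powerSum p x = p 0 + x * powerSum (fun j => p (j + 1)) x := by
  rw [powerSum, (hp.summable x).tsum_eq_zero_add, powerSum, ← tsum_mul_left]
  simp only [pow_zero, mul_one]
  congr 1
  exact tsum_congr fun j => by ring

theorem hasDerivAt_powerSum {p : ℕ → ℝ} (hp : FactorialDecay p) (x : ℝ) :
    HasDerivAt (powerSum p) (powerSum (derivCoeff p) x) x := by
  -- Any radius exceeding `|x|` works: the differentiated series is dominated uniformly on that
  -- ball.
  set R : ℝ := |x| + 1 with hR
  have hR0 : 0 < R := by positivity
  have hu : Summable fun j : ℕ => |derivCoeff p j| * R ^ j := by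
    have := (hp.deriv.summable R).abs
    simpa only [abs_mul, abs_pow, abs_of_pos hR0] using this
  have hu' : Summable fun j : ℕ => |(j : ℝ) * p j| * R ^ (j - 1) := by
    rw [← summable_nat_add_iff 1]
    refine hu.congr fun j => ?_
    simp [derivCoeff]
  have hsum : powerSum (derivCoeff p) x = ∑' j : ℕ, p j * (j * x ^ (j - 1)) := by
    have hs : Summable fun j : ℕ => p j * (j * x ^ (j - 1)) := by
      refine Summable.of_norm_bounded hu' fun j => ?_
      rw [Real.norm_eq_abs, ← mul_assoc, abs_mul, mul_comm (p j), abs_pow]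
      gcongr
      linarith
    rw [hs.tsum_eq_zero_add]
    simp only [Nat.cast_zero, zero_mul, mul_zero, zero_add, powerSum, derivCoeff]
    exact tsum_congr fun j => by push_cast; ring
  rw [hsum]
  change HasDerivAt (fun y => ∑' j, p j * y ^ j) _ x
  refine hasDerivAt_tsum_of_isPreconnected (u := fun j : ℕ => |(j : ℝ) * p j| * R ^ (j - 1))
    (t := Metric.ball 0 R) (y₀ := 0) (g := fun j y => p j * y ^ j)
    (g' := fun j y => p j * (j * y ^ (j - 1))) hu'
    Metric.isOpen_ball (convex_ball 0 R).isPreconnected ?_ ?_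
    (Metric.mem_ball_self hR0) (hp.summable 0) ?_
  · intro j y _
    exact (hasDerivAt_pow j y).const_mul (p j)
  · intro j y hy
    rw [Metric.mem_ball, dist_zero_right, Real.norm_eq_abs] at hy
    rw [Real.norm_eq_abs, ← mul_assoc, abs_mul, mul_comm (p j), abs_pow]
    gcongr
  · simp [hR]

theorem const_mul_powerSum (a : ℝ) (p : ℕ → ℝ) (x : ℝ) :
    a * powerSum p x = powerSum (fun j => a * p j) x := by
  rw [powerSum, powerSum, ← tsum_mul_left]
  exact tsum_congr fun j => by ring

theorem mul_powerSum_derivCoeff {p : ℕ → ℝ} (hp : FactorialDecay p) (x : ℝ) :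
    x * powerSum (derivCoeff p) x = ∑' j : ℕ, (j * p j) * x ^ j := by
  have hs : Summable fun j : ℕ => (j * p j) * x ^ j := by
    rw [← summable_nat_add_iff 1]
    refine ((hp.deriv.summable x).mul_left x).congr fun j => ?_
    simp only [derivCoeff]; push_cast; ring
  rw [hs.tsum_eq_zero_add, powerSum, ← tsum_mul_left]
  simp only [Nat.cast_zero, zero_mul, zero_add]
  exact tsum_congr fun j => by simp only [derivCoeff]; push_cast; ring

/-- If `j pⱼ + a pⱼ = qⱼ` then `x P' + a P = Q`. -/
theorem euler_powerSum {p q : ℕ → ℝ} {a : ℝ} (hp : FactorialDecay p)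
    (h : ∀ j : ℕ, (j + a) * p j = q j) (x : ℝ) :
    x * powerSum (derivCoeff p) x + a * powerSum p x = powerSum q x := by
  have hs : Summable fun j : ℕ => (j * p j) * x ^ j := by
    rw [← summable_nat_add_iff 1]
    refine ((hp.deriv.summable x).mul_left x).congr fun j => ?_
    simp only [derivCoeff]; push_cast; ring
  rw [mul_powerSum_derivCoeff hp, powerSum, ← tsum_mul_left,
    ← hs.tsum_add ((hp.summable x).mul_left a), powerSum]
  exact tsum_congr fun j => by rw [← h j]; ring

/-! ### The Bessel-type function ₀F₁ -/

/-- The coefficients of `₀F₁(; c; -x)`. -/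
def besselCoeff (c : ℝ) (j : ℕ) : ℝ :=
  (-1) ^ j / (j.factorial * (ascPochhammer ℝ j).eval c)

theorem min_one_le_ascPochhammer {c : ℝ} (hc : 0 < c) (j : ℕ) :
    min 1 c ≤ (ascPochhammer ℝ j).eval c := by
  have h1 : ∀ i : ℕ, c ≤ (ascPochhammer ℝ (i + 1)).eval c := by
    intro i
    induction i with
    | zero => simp
    | succ i ih =>
      rw [ascPochhammer_succ_eval]
      refine ih.trans (le_mul_of_one_le_right (hc.le.trans ih) ?_)
      push_cast
      nlinarith [(Nat.cast_nonneg i : (0 : ℝ) ≤ i)]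
  cases j with
  | zero => simp
  | succ i => exact (min_le_right _ _).trans (h1 i)

theorem factorialDecay_besselCoeff {c : ℝ} (hc : 0 < c) : FactorialDecay (besselCoeff c) := by
  refine ⟨(min 1 c)⁻¹, fun j => ?_⟩
  have h0 : 0 < min 1 c := lt_min one_pos hc
  have h1 := min_one_le_ascPochhammer hc j
  rw [besselCoeff, abs_div, abs_pow, abs_neg, abs_one, one_pow, abs_mul, Nat.abs_cast,
    abs_of_pos (h0.trans_le h1), inv_eq_one_div, div_div, mul_comm]
  gcongr

/-- The function `₀F₁(; c; -x)`. -/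
def besselSum (c : ℝ) : ℝ → ℝ := powerSum (besselCoeff c)

theorem besselSum_zero (c : ℝ) : besselSum c 0 = 1 := by
  simp [besselSum, powerSum_zero, besselCoeff]

/-- Bessel's equation `x B'' + c B' = -B`, obtained by applying `euler_powerSum` to the coefficients
of `B'`. -/
theorem besselSum_ode {c : ℝ} (hc : 0 < c) (x : ℝ) :
    x * powerSum (derivCoeff (derivCoeff (besselCoeff c))) x
      + c * powerSum (derivCoeff (besselCoeff c)) x = - besselSum c x := by
  rw [besselSum, neg_eq_neg_one_mul, const_mul_powerSum (-1)]
  refine euler_powerSum (factorialDecay_besselCoeff hc).deriv (fun j => ?_) x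
  have h1 := ascPochhammer_pos j c hc
  have hcj : 0 < c + j := by positivity
  simp only [derivCoeff, besselCoeff, ascPochhammer_succ_eval, Nat.factorial_succ]
  push_cast
  field_simp
  ring

/-- By Bessel's equation the energy `B² + x B'²` has derivative `(1 - 2c) B'² ≤ 0`, and it equals
`1` at `x = 0`. -/
theorem abs_besselSum_le_one {c : ℝ} (hc : 1 / 2 ≤ c) {x : ℝ} (hx : 0 ≤ x) :
    |besselSum c x| ≤ 1 := by
  have hc0 : 0 < c := by linarith
  have hp := factorialDecay_besselCoeff hc0
  set B := besselSum c with hB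
  set B1 := powerSum (derivCoeff (besselCoeff c)) with hB1
  set B2 := powerSum (derivCoeff (derivCoeff (besselCoeff c))) with hB2
  have hd : ∀ y, HasDerivAt (fun y => B y ^ 2 + y * B1 y ^ 2) ((1 - 2 * c) * B1 y ^ 2) y := by
    intro y
    have h1 : HasDerivAt B (B1 y) y := hasDerivAt_powerSum hp y
    have h2 : HasDerivAt B1 (B2 y) y := hasDerivAt_powerSum hp.deriv y
    have h3 : y * B2 y + c * B1 y = - B y := besselSum_ode hc0 y
    convert! (h1.pow 2).add ((hasDerivAt_id y).mul (h2.pow 2)) using 1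
    simp
    linear_combination (- 2 * B1 y) * h3
  have hanti : Antitone fun y => B y ^ 2 + y * B1 y ^ 2 :=
    antitone_of_hasDerivAt_nonpos hd fun y =>
      mul_nonpos_of_nonpos_of_nonneg (by linarith) (sq_nonneg _)
  have h := hanti hx
  simp only [hB, besselSum_zero, zero_mul, add_zero, one_pow] at h
  have h4 : 0 ≤ x * B1 x ^ 2 := by positivity
  exact abs_le_one_iff_mul_self_le_one.2 (by nlinarith)

theorem hasDerivAt_besselSum {c : ℝ} (hc : 0 < c) (x : ℝ) :
    HasDerivAt (besselSum c) (-c⁻¹ * besselSum (c + 1) x) x := by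
  convert! hasDerivAt_powerSum (factorialDecay_besselCoeff hc) x using 1
  rw [besselSum, const_mul_powerSum]
  congr 1
  ext j
  have h1 := ascPochhammer_pos j (c + 1) (by linarith)
  have h2 : (ascPochhammer ℝ (j + 1)).eval c = c * (ascPochhammer ℝ j).eval (c + 1) := by
    simp [ascPochhammer_succ_left]
  simp only [derivCoeff, besselCoeff, h2, Nat.factorial_succ]
  push_cast
  field_simp
  ring

/-- Differentiation raises the parameter, so `y + c B_c(y)` has derivative `1 - B_{c+1}(y)`,
nonnegative by the previous bound at `c + 1`. -/
theorem one_sub_besselSum_le {c : ℝ} (hc : 1 / 2 ≤ c) {x : ℝ} (hx : 0 ≤ x) :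
    c * (1 - besselSum c x) ≤ x := by
  have hc0 : 0 < c := by linarith
  have hd : ∀ y, HasDerivAt (fun y => y + c * besselSum c y) (1 - besselSum (c + 1) y) y := by
    intro y
    convert! (hasDerivAt_id y).add ((hasDerivAt_besselSum hc0 y).const_mul c) using 1
    field_simp
    ring
  have hm : MonotoneOn (fun y => y + c * besselSum c y) (Set.Ici 0) := by
    refine monotoneOn_of_deriv_nonneg (convex_Ici 0)
      (fun y _ => (hd y).continuousAt.continuousWithinAt)
      (fun y _ => (hd y).differentiableAt.differentiableWithinAt) fun y hy => ?_
    rw [interior_Ici] at hy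
    rw [(hd y).deriv]
    linarith [(abs_le.1 (abs_besselSum_le_one (c := c + 1) (by linarith) (le_of_lt hy))).2]
  have h := hm Set.self_mem_Ici (Set.mem_Ici.2 hx) hx
  simp only [besselSum_zero] at h
  linarith

/-! ### The kernel ₁F₂ and its bounds -/

/-- The coefficients of `₁F₂(1; 2, c + 1; -x)`. -/
def kernelCoeff (c : ℝ) (j : ℕ) : ℝ :=
  (-1) ^ j / ((j + 1).factorial * (ascPochhammer ℝ j).eval (c + 1))

theorem kernelCoeff_eq {c : ℝ} (hc : 0 < c) (j : ℕ) :
    besselCoeff c (j + 1) = -c⁻¹ * kernelCoeff c j := by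
  have h1 := ascPochhammer_pos j (c + 1) (by linarith)
  have h2 : (ascPochhammer ℝ (j + 1)).eval c = c * (ascPochhammer ℝ j).eval (c + 1) := by
    simp [ascPochhammer_succ_left]
  simp only [besselCoeff, kernelCoeff, h2]
  field_simp
  ring

theorem factorialDecay_kernelCoeff {c : ℝ} (hc : 0 < c) : FactorialDecay (kernelCoeff c) := by
  refine ⟨1, fun j => ?_⟩
  have h1 := min_one_le_ascPochhammer (c := c + 1) (by linarith) j
  rw [min_eq_left (by linarith)] at h1
  rw [kernelCoeff, abs_div, abs_pow, abs_neg, abs_one, one_pow, abs_of_pos (by positivity)]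
  have h2 : (j.factorial : ℝ) ≤ (j + 1).factorial := by
    exact_mod_cast Nat.factorial_le (Nat.le_succ j)
  have h3 : (0 : ℝ) < j.factorial := by positivity
  exact one_div_le_one_div_of_le h3 (by nlinarith)

/-- The function `₁F₂(1; 2, c + 1; -x)`. -/
def kernelSum (c : ℝ) : ℝ → ℝ := powerSum (kernelCoeff c)

/-- Up to the factor `-1/c`, the kernel is the Bessel series with its constant term removed and the
index shifted; Bessel bounds thereby become bounds on the kernel. -/
theorem mul_kernelSum {c : ℝ} (hc : 0 < c) (x : ℝ) :
    x * kernelSum c x = c * (1 - besselSum c x) := by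
  have h := powerSum_eq_add_mul (factorialDecay_besselCoeff hc) x
  simp only [kernelCoeff_eq hc] at h
  rw [← const_mul_powerSum, ← kernelSum, ← besselSum] at h
  rw [h]
  simp [besselCoeff]
  field_simp

theorem kernelSum_nonneg {c : ℝ} (hc : 1 / 2 ≤ c) {x : ℝ} (hx : 0 < x) : 0 ≤ kernelSum c x := by
  refine nonneg_of_mul_nonneg_right (a := x) ?_ hx
  rw [mul_kernelSum (by linarith)]
  exact mul_nonneg (by linarith)
    (by linarith [(abs_le.1 (abs_besselSum_le_one hc hx.le)).2])

theorem kernelSum_le_one {c : ℝ} (hc : 1 / 2 ≤ c) {x : ℝ} (hx : 0 < x) : kernelSum c x ≤ 1 := by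
  refine le_of_mul_le_mul_left (a := x) ?_ hx
  rw [mul_kernelSum (by linarith), mul_one]
  exact one_sub_besselSum_le hc hx.le

/-! ### The normalized symbol ₂F₃ -/

/-- The quotient `(a)ⱼ / (a + 1)ⱼ`. -/
def pochRatio (a : ℝ) (j : ℕ) : ℝ :=
  (ascPochhammer ℝ j).eval a / (ascPochhammer ℝ j).eval (a + 1)

/-- Both `(a)ⱼ (a + j)` and `a (a + 1)ⱼ` equal `(a)ⱼ₊₁`. The product form remains valid at `a = 0`,
`j = 0`, where dividing by `j + a` would fail. -/
theorem add_mul_pochRatio {a : ℝ} (ha : -1 < a) (j : ℕ) : (j + a) * pochRatio a j = a := by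
  have h1 := ascPochhammer_pos j (a + 1) (by linarith)
  have h2 : (ascPochhammer ℝ (j + 1)).eval a = a * (ascPochhammer ℝ j).eval (a + 1) := by
    simp [ascPochhammer_succ_left]
  rw [ascPochhammer_succ_eval] at h2
  rw [pochRatio]
  field_simp
  linarith

theorem pochRatio_zero (a : ℝ) : pochRatio a 0 = 1 := by simp [pochRatio]

theorem pochRatio_succ {a : ℝ} (ha : -1 < a) (j : ℕ) :
    pochRatio a (j + 1) = a / (j + 1 + a) := by
  have h := add_mul_pochRatio ha (j + 1)
  have : (0 : ℝ) < j + 1 + a := by linarith [(Nat.cast_nonneg j : (0 : ℝ) ≤ j)]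
  push_cast at h
  field_simp
  linarith

theorem abs_pochRatio_le {a : ℝ} (ha : -1 < a) (j : ℕ) :
    |pochRatio a j| ≤ max 1 (|a| / (1 + a)) := by
  cases j with
  | zero => simp [pochRatio_zero]
  | succ j =>
    refine le_max_of_le_right ?_
    have hj : (0 : ℝ) ≤ j := Nat.cast_nonneg j
    rw [pochRatio_succ ha, abs_div, abs_of_pos (a := (j : ℝ) + 1 + a) (by linarith)]
    exact div_le_div_of_nonneg_left (abs_nonneg a) (by linarith) (by linarith)

/-- The normalized multiplier `₂F₃(1, a; 2, c + 1, a + 1; -x)`. -/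
def symbolSum (c a x : ℝ) : ℝ := hypergeometric2F3 1 a 2 (c + 1) (a + 1) (-x)

theorem symbolSum_eq (c a : ℝ) :
    symbolSum c a = powerSum fun j => pochRatio a j * kernelCoeff c j := by
  ext x
  refine tsum_congr fun j => ?_
  have h1 : (ascPochhammer ℝ j).eval 1 = j.factorial := ascPochhammer_eval_one ℝ j
  have h2 : (ascPochhammer ℝ j).eval 2 = (j + 1).factorial := by
    have h := ascPochhammer_eval_one ℝ (j + 1)
    rw [ascPochhammer_succ_left] at h
    simpa [one_add_one_eq_two] using h
  have h3 : (j.factorial : ℝ) ≠ 0 := by positivity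
  simp only [h1, h2, pochRatio, kernelCoeff, neg_pow x]
  field_simp

theorem factorialDecay_symbol {c a : ℝ} (hc : 0 < c) (ha : -1 < a) :
    FactorialDecay fun j => pochRatio a j * kernelCoeff c j :=
  (factorialDecay_kernelCoeff hc).mul_bounded (abs_pochRatio_le ha)

theorem symbolSum_zero_right (c a : ℝ) : symbolSum c a 0 = 1 := by
  simp [symbolSum_eq, powerSum_zero, pochRatio_zero, kernelCoeff]

theorem symbolSum_zero_left (c x : ℝ) : symbolSum c 0 x = 1 := by
  rw [symbolSum_eq, powerSum, tsum_eq_single 0]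
  · simp [pochRatio_zero, kernelCoeff]
  · intro j hj
    obtain ⟨i, rfl⟩ := Nat.exists_eq_succ_of_ne_zero hj
    simp [pochRatio_succ]

/-- The derivative of the normalized multiplier. -/
def symbolDeriv (c a : ℝ) : ℝ → ℝ :=
  powerSum (derivCoeff fun j => pochRatio a j * kernelCoeff c j)

theorem hasDerivAt_symbolSum {c a : ℝ} (hc : 0 < c) (ha : -1 < a) (x : ℝ) :
    HasDerivAt (symbolSum c a) (symbolDeriv c a x) x := by
  rw [symbolSum_eq]
  exact hasDerivAt_powerSum (factorialDecay_symbol hc ha) x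

theorem euler_symbolSum {c a : ℝ} (hc : 0 < c) (ha : -1 < a) (x : ℝ) :
    x * symbolDeriv c a x + a * symbolSum c a x = a * kernelSum c x := by
  rw [symbolSum_eq, kernelSum, const_mul_powerSum a (kernelCoeff c)]
  exact euler_powerSum (factorialDecay_symbol hc ha)
    (fun j => by rw [← mul_assoc, add_mul_pochRatio ha]) x

/-- `xᵃ` is the integrating factor of the Euler equation. The free constant `d` is chosen later to
fix the sign of `a (K - d)`: `0` for `a > 0`, `1` for `a < 0`. -/
theorem hasDerivAt_rpow_mul_symbolSum {c a : ℝ} (hc : 0 < c) (ha : -1 < a) (d : ℝ) {x : ℝ}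
    (hx : 0 < x) : HasDerivAt (fun y => y ^ a * (symbolSum c a y - d))
      (x ^ (a - 1) * (a * (kernelSum c x - d))) x := by
  have h1 := (Real.hasDerivAt_rpow_const (p := a) (Or.inl hx.ne')).mul
    ((hasDerivAt_symbolSum hc ha x).sub_const d)
  convert! h1 using 1
  have h2 : x ^ a = x ^ (a - 1) * x := by
    rw [← Real.rpow_add_one hx.ne', sub_add_cancel]
  rw [h2]
  linear_combination (- x ^ (a - 1)) * euler_symbolSum hc ha x

theorem monotoneOn_rpow_mul_symbolSum {c a d : ℝ} (hc : 0 < c) (ha : -1 < a)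
    (hd : ∀ x, 0 < x → 0 ≤ a * (kernelSum c x - d)) :
    MonotoneOn (fun y => y ^ a * (symbolSum c a y - d)) (Set.Ioi 0) := by
  refine monotoneOn_of_deriv_nonneg (convex_Ioi 0)
    (fun y hy => (hasDerivAt_rpow_mul_symbolSum hc ha d hy).continuousAt.continuousWithinAt)
    (fun y hy => ?_) fun y hy => ?_
  · rw [interior_Ioi] at hy
    exact (hasDerivAt_rpow_mul_symbolSum hc ha d hy).differentiableAt.differentiableWithinAt
  · rw [interior_Ioi] at hy
    rw [(hasDerivAt_rpow_mul_symbolSum hc ha d hy).deriv]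
    exact mul_nonneg (Real.rpow_nonneg (le_of_lt hy) _) (hd y hy)

theorem rpow_mul_symbolSum_mono {c a : ℝ} (hc : 1 / 2 ≤ c) (ha : 0 < a) {x y : ℝ} (hx : 0 < x)
    (hxy : x ≤ y) : x ^ a * symbolSum c a x ≤ y ^ a * symbolSum c a y := by
  have h := monotoneOn_rpow_mul_symbolSum (c := c) (a := a) (d := 0) (by linarith) (by linarith)
    (fun x hx => by rw [sub_zero]; exact mul_nonneg ha.le (kernelSum_nonneg hc hx))
    (Set.mem_Ioi.2 hx) (Set.mem_Ioi.2 (hx.trans_le hxy)) hxy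
  simpa using h

theorem rpow_mul_symbolSum_sub_mono {c a : ℝ} (hc : 1 / 2 ≤ c) (ha : -1 < a) (ha0 : a < 0)
    {x y : ℝ} (hx : 0 < x) (hxy : x ≤ y) :
    x ^ a * (symbolSum c a x - 1) ≤ y ^ a * (symbolSum c a y - 1) :=
  monotoneOn_rpow_mul_symbolSum (c := c) (a := a) (d := 1) (by linarith) ha
    (fun x hx => mul_nonneg_of_nonpos_of_nonpos ha0.le
      (by linarith [kernelSum_le_one hc hx]))
    (Set.mem_Ioi.2 hx) (Set.mem_Ioi.2 (hx.trans_le hxy)) hxy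

/-- The monotone quantity lives on `x > 0`, so its sign must be seeded at a small positive point;
continuity and `S(0) = 1` provide one. -/
theorem exists_symbolSum_pos {c a : ℝ} (hc : 0 < c) (ha : -1 < a) {y : ℝ} (hy : 0 < y) :
    ∃ x, 0 < x ∧ x ≤ y ∧ 0 < symbolSum c a x := by
  have h1 : ∀ᶠ x in 𝓝[>] (0 : ℝ), 0 < symbolSum c a x :=
    ((hasDerivAt_symbolSum hc ha 0).continuousAt.eventually
      (lt_mem_nhds (by rw [symbolSum_zero_right]; exact one_pos))).filter_mono
      nhdsWithin_le_nhds
  obtain ⟨x, h2, h3⟩ := (h1.and (Ioc_mem_nhdsGT hy)).exists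
  exact ⟨x, h3.1, h3.2, h2⟩

/-- For `-1 < a < 0` the slope `S'(0) = -a / (2 (1 + a) (c + 1))` is positive, so `S` leaves the
value `1` upwards. -/
theorem exists_one_lt_symbolSum {c a : ℝ} (hc : 0 < c) (ha : -1 < a) (ha0 : a < 0) {y : ℝ}
    (hy : 0 < y) : ∃ x, 0 < x ∧ x ≤ y ∧ 1 < symbolSum c a x := by
  have h0 : 0 < symbolDeriv c a 0 := by
    rw [symbolDeriv, powerSum_zero, derivCoeff, pochRatio_succ ha, kernelCoeff]
    simp only [Nat.cast_zero, zero_add, pow_one, ascPochhammer_one, Polynomial.eval_X, one_mul]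
    have : 0 < ((1 + 1 : ℕ).factorial : ℝ) * (c + 1) := by positivity
    exact mul_pos_of_neg_of_neg (div_neg_of_neg_of_pos ha0 (by linarith))
      (div_neg_of_neg_of_pos (by norm_num) this)
  have h1 := (hasDerivAt_iff_tendsto_slope.1 (hasDerivAt_symbolSum hc ha 0)).eventually
    (lt_mem_nhds h0)
  have h2 : ∀ᶠ x in 𝓝[>] (0 : ℝ), 0 < slope (symbolSum c a) 0 x :=
    h1.filter_mono (nhdsWithin_mono _ fun x hx => ne_of_gt hx)
  obtain ⟨x, h3, h4⟩ := (h2.and (Ioc_mem_nhdsGT hy)).exists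
  refine ⟨x, h4.1, h4.2, ?_⟩
  rw [slope_def_field, symbolSum_zero_right, sub_zero] at h3
  have := (div_pos_iff_of_pos_right h4.1).1 h3
  linarith

theorem one_le_symbolSum {c a : ℝ} (hc : 1 / 2 ≤ c) (ha : -1 < a) (ha0 : a ≤ 0) {x : ℝ}
    (hx : 0 ≤ x) : 1 ≤ symbolSum c a x := by
  rcases hx.eq_or_lt with rfl | hx
  · rw [symbolSum_zero_right]
  rcases ha0.eq_or_lt with rfl | ha0
  · rw [symbolSum_zero_left]
  obtain ⟨y, hy, hyx, h1⟩ := exists_one_lt_symbolSum (c := c) (by linarith) ha ha0 hx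
  have h2 := rpow_mul_symbolSum_sub_mono hc ha ha0 hy hyx
  have h3 : 0 < x ^ a * (symbolSum c a x - 1) :=
    lt_of_lt_of_le (mul_pos (Real.rpow_pos_of_pos hy a) (by linarith)) h2
  linarith [(mul_pos_iff_of_pos_left (Real.rpow_pos_of_pos hx a)).1 h3]

theorem symbolSum_pos {c a : ℝ} (hc : 1 / 2 ≤ c) (ha : -1 < a) {x : ℝ} (hx : 0 ≤ x) :
    0 < symbolSum c a x := by
  rcases le_or_gt a 0 with ha0 | ha0
  · exact one_pos.trans_le (one_le_symbolSum hc ha ha0 hx)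
  rcases hx.eq_or_lt with rfl | hx
  · rw [symbolSum_zero_right]; exact one_pos
  obtain ⟨y, hy, hyx, h1⟩ := exists_symbolSum_pos (c := c) (by linarith) ha hx
  have h2 := rpow_mul_symbolSum_mono hc ha0 hy hyx
  exact (mul_pos_iff_of_pos_left (Real.rpow_pos_of_pos hx a)).1
    ((mul_pos (Real.rpow_pos_of_pos hy a) h1).trans_le h2)

/-- For `a ≠ 0`, `C` is the value of the monotone quantity at a seed point `y ≤ 1`, hence a lower
bound for it at every `x ≥ 1`. -/
theorem exists_rpow_le_symbolSum {c a : ℝ} (hc : 1 / 2 ≤ c) (ha : -1 < a) :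
    ∃ C, 0 < C ∧ ∀ x, 1 ≤ x → C * x ^ (-a) ≤ symbolSum c a x := by
  have key : ∀ {C x s : ℝ}, 1 ≤ x → C ≤ x ^ a * s → C * x ^ (-a) ≤ s := by
    intro C x s hx h
    have hx0 : 0 < x := by linarith
    rw [Real.rpow_neg hx0.le, ← div_eq_mul_inv, div_le_iff₀ (Real.rpow_pos_of_pos hx0 a)]
    linarith
  rcases lt_trichotomy a 0 with ha0 | rfl | ha0
  · obtain ⟨y, hy, hy1, h1⟩ := exists_one_lt_symbolSum (c := c) (by linarith) ha ha0 one_pos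
    refine ⟨y ^ a * (symbolSum c a y - 1),
      mul_pos (Real.rpow_pos_of_pos hy a) (by linarith), fun x hx => ?_⟩
    have := key hx (rpow_mul_symbolSum_sub_mono hc ha ha0 hy (hy1.trans hx))
    linarith
  · exact ⟨1, one_pos, fun x _ => by simp [symbolSum_zero_left]⟩
  · obtain ⟨y, hy, hy1, h1⟩ := exists_symbolSum_pos (c := c) (by linarith) ha one_pos
    exact ⟨y ^ a * symbolSum c a y, mul_pos (Real.rpow_pos_of_pos hy a) h1, fun x hx =>
      key hx (rpow_mul_symbolSum_mono hc ha0 hy (hy1.trans hx))⟩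

theorem tendsto_symbolSum {c : ℝ} (hc : 0 < c) (x : ℝ) :
    Filter.Tendsto (fun a => symbolSum c a x) (𝓝 0) (𝓝 1) := by
  rw [← symbolSum_zero_left c x]
  simp only [symbolSum_eq, powerSum]
  have hs := (factorialDecay_kernelCoeff hc).summable x
  refine tendsto_tsum_of_dominated_convergence hs.abs (fun j => ?_) ?_
  · refine Filter.Tendsto.mul_const _ (Filter.Tendsto.mul_const _ ?_)
    cases j with
    | zero => simp only [pochRatio_zero]; exact tendsto_const_nhds
    | succ j =>
      have h1 : ∀ᶠ a : ℝ in 𝓝 0, a / (j + 1 + a) = pochRatio a (j + 1) := by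
        filter_upwards [lt_mem_nhds (show (-1 : ℝ) < 0 by norm_num)] with a ha
        rw [pochRatio_succ ha]
      refine Filter.Tendsto.congr' h1 ?_
      rw [pochRatio_succ (by norm_num)]
      refine ContinuousAt.tendsto (f := fun a : ℝ => a / (j + 1 + a)) ?_
      refine continuousAt_id.div (continuousAt_const.add continuousAt_id) ?_
      simp only [add_zero]
      positivity
  -- For `a > -1/2` one has `|a| ≤ 1 + a`, so every ratio is at most `1` in absolute value and the
  -- kernel series dominates.
  · filter_upwards [Ioo_mem_nhds (show (-1 / 2 : ℝ) < 0 by norm_num) one_pos] with a ha j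
    rw [Real.norm_eq_abs, mul_assoc, abs_mul]
    refine mul_le_of_le_one_left (abs_nonneg _) ?_
    refine (abs_pochRatio_le (by linarith [ha.1]) j).trans (max_le le_rfl ?_)
    rw [div_le_one (by linarith [ha.1]), abs_le]
    constructor <;> linarith [ha.1, ha.2]

/-! ### The scalar forced oscillator -/

/-- The solution of `u'' = -lam u + 1`, `u(0) = u'(0) = 0`. -/
def waveKernel (lam t : ℝ) : ℝ := t ^ 2 / 2 * Real.sinc (√lam * t / 2) ^ 2

/-- The time derivative of `waveKernel`. -/
def waveVelocity (lam t : ℝ) : ℝ := t * Real.sinc (√lam * t)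

/-- Writing the kernel with `sinc` removes the singularity of `(1 - cos (√lam t)) / lam` at `lam =
0`. Continuity transfers convergence of symbols to convergence of solution coefficients. -/
theorem continuous_waveKernel (t : ℝ) : Continuous fun lam => waveKernel lam t := by
  unfold waveKernel
  have := Real.continuous_sinc
  fun_prop

theorem mul_sinc (x : ℝ) : x * Real.sinc x = Real.sin x := by
  rcases eq_or_ne x 0 with rfl | hx
  · simp
  · rw [Real.sinc_of_ne_zero hx]; field_simp

theorem waveKernel_zero_right (lam : ℝ) : waveKernel lam 0 = 0 := by simp [waveKernel]

theorem waveVelocity_zero_right (lam : ℝ) : waveVelocity lam 0 = 0 := by simp [waveVelocity]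

theorem mul_waveKernel {lam : ℝ} (h : 0 ≤ lam) (t : ℝ) :
    lam * waveKernel lam t = 1 - Real.cos (√lam * t) := by
  have h1 := mul_sinc (√lam * t / 2)
  have h2 := Real.sq_sqrt h
  have h3 : Real.cos (√lam * t) = 1 - 2 * Real.sin (√lam * t / 2) ^ 2 := by
    have := Real.cos_two_mul (√lam * t / 2)
    rw [show 2 * (√lam * t / 2) = √lam * t by ring] at this
    nlinarith [Real.sin_sq_add_cos_sq (√lam * t / 2)]
  rw [h3, ← h1, waveKernel]
  linear_combination (- (t ^ 2 / 2 * Real.sinc (√lam * t / 2) ^ 2)) * h2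

theorem sqrt_mul_waveVelocity (lam t : ℝ) :
    √lam * waveVelocity lam t = Real.sin (√lam * t) := by
  rw [← mul_sinc, waveVelocity, mul_assoc]

theorem hasDerivAt_waveKernel {lam : ℝ} (h : 0 ≤ lam) (t : ℝ) :
    HasDerivAt (waveKernel lam) (waveVelocity lam t) t := by
  rcases h.eq_or_lt with rfl | h0
  · have : waveKernel 0 = fun t => t ^ 2 / 2 := by ext t; simp [waveKernel]
    rw [this]
    convert! (hasDerivAt_pow 2 t).div_const 2 using 1
    simp [waveVelocity]
  · have h1 : waveKernel lam = fun t => (1 - Real.cos (√lam * t)) / lam := by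
      ext t; rw [← mul_waveKernel h]; field_simp
    rw [h1]
    have h2 : HasDerivAt (fun t => √lam * t) √lam t := by
      simpa using (hasDerivAt_id t).const_mul √lam
    convert! (h2.cos.const_sub 1).div_const lam using 1
    rw [← sqrt_mul_waveVelocity]
    have := Real.sq_sqrt h
    field_simp
    linear_combination (-waveVelocity lam t) * this

theorem hasDerivAt_waveVelocity (lam t : ℝ) :
    HasDerivAt (waveVelocity lam) (Real.cos (√lam * t)) t := by
  -- Splitting on `√lam` also covers negative `lam`, where `√lam = 0` by convention.
  rcases eq_or_ne √lam 0 with h | h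
  · have : waveVelocity lam = fun t => t := by ext t; simp [waveVelocity, h]
    rw [this, h]
    simpa using hasDerivAt_id' t
  · have h1 : waveVelocity lam = fun t => Real.sin (√lam * t) / √lam := by
      ext t; rw [← sqrt_mul_waveVelocity]; field_simp
    rw [h1]
    have h2 : HasDerivAt (fun t => √lam * t) √lam t := by
      simpa using (hasDerivAt_id t).const_mul √lam
    convert! h2.sin.div_const √lam using 1
    field_simp

theorem waveKernel_nonneg (lam t : ℝ) : 0 ≤ waveKernel lam t := by
  unfold waveKernel; positivity

theorem waveKernel_le (lam t : ℝ) : waveKernel lam t ≤ t ^ 2 / 2 := by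
  refine mul_le_of_le_one_right (by positivity) ?_
  exact (sq_le_one_iff_abs_le_one _).2 (Real.abs_sinc_le_one _)

theorem waveKernel_le_two_div {lam : ℝ} (h : 0 < lam) (t : ℝ) : waveKernel lam t ≤ 2 / lam := by
  rw [le_div_iff₀ h, mul_comm, mul_waveKernel h.le]
  linarith [Real.neg_one_le_cos (√lam * t)]

theorem abs_waveVelocity_le (lam t : ℝ) : |waveVelocity lam t| ≤ |t| := by
  rw [waveVelocity, abs_mul]
  exact mul_le_of_le_one_right (abs_nonneg t) (Real.abs_sinc_le_one _)

/-- The Lipschitz constant is independent of `lam`, so it dominates the difference quotients of all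
modes at once. -/
theorem abs_waveKernel_sub_le {lam : ℝ} (h : 0 ≤ lam) {t s : ℝ} (hs : |s| ≤ 1) :
    |waveKernel lam (t + s) - waveKernel lam t| ≤ (|t| + 1) * |s| := by
  have h1 := (convex_closedBall t 1).norm_image_sub_le_of_norm_hasDerivWithin_le
    (f := waveKernel lam) (f' := waveVelocity lam) (C := |t| + 1) (x := t) (y := t + s)
    (fun x _ => (hasDerivAt_waveKernel h x).hasDerivWithinAt) (fun x hx => ?_)
    (Metric.mem_closedBall_self zero_le_one) (by simpa using hs)
  · simpa using h1
  · rw [Metric.mem_closedBall, Real.dist_eq] at hx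
    refine (abs_waveVelocity_le lam x).trans ?_
    have := abs_add_le (x - t) t
    rw [sub_add_cancel] at this
    linarith

theorem abs_waveVelocity_sub_le (lam t s : ℝ) :
    |waveVelocity lam (t + s) - waveVelocity lam t| ≤ |s| := by
  have h1 := convex_univ.norm_image_sub_le_of_norm_hasDerivWithin_le
    (f := waveVelocity lam) (f' := fun x => Real.cos (√lam * x)) (C := 1) (x := t) (y := t + s)
    (fun x _ => (hasDerivAt_waveVelocity lam x).hasDerivWithinAt)
    (fun x _ => Real.abs_cos_le_one _) (Set.mem_univ _) (Set.mem_univ _)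
  simpa using h1

/-- If `lam ≥ c xʳ` for large `x`, then `(1 + x)ʳ` times the wave kernel is bounded. -/
theorem rpow_mul_waveKernel_le {c R r t x lam : ℝ} (hc : 0 < c) (hR : 1 ≤ R) (hr : 0 ≤ r)
    (hx : 0 ≤ x) (h : R ≤ x → c * x ^ r ≤ lam) :
    (1 + x) ^ r * waveKernel lam t ≤ (1 + R) ^ r * (t ^ 2 / 2) + 2 ^ r * (2 / c) := by
  have hu := waveKernel_nonneg lam t
  -- High frequencies use `w ≤ 2 / lam`; low ones use `w ≤ t² / 2` and a bounded weight.
  rcases le_or_gt R x with hxR | hxR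
  · have hx0 : 0 < x := by linarith
    have hxr : 0 < x ^ r := Real.rpow_pos_of_pos hx0 r
    have h1 : (1 + x) ^ r ≤ 2 ^ r * x ^ r := by
      rw [← Real.mul_rpow (by norm_num) hx]
      exact Real.rpow_le_rpow (by linarith) (by linarith) hr
    have h2 : waveKernel lam t ≤ 2 / (c * x ^ r) := by
      have h3 : 0 < c * x ^ r := by positivity
      exact (waveKernel_le_two_div (h3.trans_le (h hxR)) t).trans
        (div_le_div_of_nonneg_left (by norm_num) h3 (h hxR))
    have h4 : 0 ≤ (1 + R) ^ r * (t ^ 2 / 2) := by positivity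
    calc (1 + x) ^ r * waveKernel lam t ≤ (2 ^ r * x ^ r) * (2 / (c * x ^ r)) := by gcongr
      _ = 2 ^ r * (2 / c) := by field_simp
      _ ≤ _ := by linarith
  · have h4 : (0 : ℝ) ≤ 2 ^ r * (2 / c) := by positivity
    have h1 : (1 + x) ^ r ≤ (1 + R) ^ r := Real.rpow_le_rpow (by linarith) (by linarith) hr
    have h2 := waveKernel_le lam t
    calc (1 + x) ^ r * waveKernel lam t ≤ (1 + R) ^ r * (t ^ 2 / 2) := by gcongr
      _ ≤ _ := by linarith

/-- Uniqueness for the oscillator equation on the half line. -/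
theorem oscillator_unique {lam : ℝ} (hlam : 0 ≤ lam) {d d1 d2 : ℝ → ℂ}
    (h1 : ∀ t, 0 ≤ t → HasDerivWithinAt d (d1 t) (Set.Ici 0) t)
    (h2 : ∀ t, 0 ≤ t → HasDerivWithinAt d1 (d2 t) (Set.Ici 0) t)
    (h3 : ∀ t, 0 < t → d2 t = -(lam : ℂ) * d t) (hd : d 0 = 0) (hd1 : d1 0 = 0)
    {t : ℝ} (ht : 0 ≤ t) : d t = 0 := by
  have hconst : ∀ {g : ℝ → ℝ} {g' : ℝ → ℝ},
      (∀ t, 0 ≤ t → HasDerivWithinAt g (g' t) (Set.Ici 0) t) → (∀ t, 0 ≤ t → g' t = 0) →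
      ∀ t, 0 ≤ t → g t = g 0 := by
    intro g g' hg hg' t ht
    refine constant_of_has_deriv_right_zero (a := 0) (b := t)
      (fun x hx => (hg x hx.1).continuousWithinAt.mono Set.Icc_subset_Ici_self)
      (fun x hx => ?_) t (Set.right_mem_Icc.2 ht)
    have := (hg x hx.1).mono (Set.Ici_subset_Ici.2 hx.1)
    rwa [hg' x hx.1] at this
  -- Conservation of energy. The equation is assumed only for `t > 0`; at `t = 0` the derivative of
  -- the energy vanishes by the initial data.
  have hE : ∀ t, 0 ≤ t → ‖d1 t‖ ^ 2 + lam * ‖d t‖ ^ 2 = 0 := by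
    intro t ht
    have := hconst (g := fun t => ‖d1 t‖ ^ 2 + lam * ‖d t‖ ^ 2)
      (fun t ht => (h2 t ht).norm_sq.add ((h1 t ht).norm_sq.const_mul lam)) (fun t ht => ?_) t ht
    · simpa [hd, hd1] using this
    · rcases ht.eq_or_lt with rfl | ht
      · simp [hd, hd1]
      · rw [h3 t ht]
        simp only [Complex.inner]
        simp
        ring
  -- If `lam = 0` the energy controls only the velocity, so `d` is recovered as a constant.
  have hd1' : ∀ t, 0 ≤ t → d1 t = 0 := by
    intro t ht
    have h := hE t ht
    have h4 : 0 ≤ lam * ‖d t‖ ^ 2 := by positivity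
    have h5 : ‖d1 t‖ ^ 2 = 0 := le_antisymm (by linarith) (sq_nonneg _)
    simpa using h5
  have := hconst (fun t ht => (h1 t ht).norm_sq) (fun t ht => by simp [hd1' t ht]) t ht
  simpa [hd] using this

/-! ### Calculus of test functions on the torus -/

/-- The integral over the fundamental cell `[0, 2π]ⁿ`. -/
def cellIntegral {n : ℕ} (f : EuclideanSpace ℝ (Fin n) → ℂ) : ℂ :=
  ∫ x in Set.Icc (0 : Fin n → ℝ) (fun _ => 2 * Real.pi), f (WithLp.toLp 2 x)

/-- Divergence theorem on the cell for the field `f eᵢ`: the contributions of opposite faces cancel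
by periodicity. -/
theorem cellIntegral_fderiv {n : ℕ} {f : EuclideanSpace ℝ (Fin n) → ℂ} (hf : ContDiff ℝ 1 f)
    (hper : ∀ (l : Fin n → ℤ) x, f (x + (2 * Real.pi) • latticeVec l) = f x) (i : Fin n) :
    cellIntegral (fun x => fderiv ℝ f x (EuclideanSpace.single i 1)) = 0 := by
  obtain _ | m := n
  · exact i.elim0
  set e := (EuclideanSpace.equiv (Fin (m + 1)) ℝ).symm with he
  have hcont : Continuous fun x => fderiv ℝ f (e x) := (hf.continuous_fderiv one_ne_zero).comp
    e.continuous
  have h := MeasureTheory.integral_divergence_of_hasFDerivAt_off_countable'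
    (0 : Fin (m + 1) → ℝ) (fun _ => 2 * Real.pi) (fun _ => by positivity)
    (fun j x => if j = i then f (e x) else 0)
    (fun j x => if j = i then (fderiv ℝ f (e x)).comp (e : (Fin (m + 1) → ℝ) →L[ℝ] _) else 0)
    ∅ Set.countable_empty ?_ ?_ ?_
  · have h1 : ∀ x, (∑ j, (if j = i then
        (fderiv ℝ f (e x)).comp (e : (Fin (m + 1) → ℝ) →L[ℝ] _) else 0) (Pi.single j 1)) =
        fderiv ℝ f (WithLp.toLp 2 x) (EuclideanSpace.single i 1) := by
      intro x
      rw [Finset.sum_eq_single i]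
      · simp only [if_true]; rfl
      · intro j _ hj; simp [hj]
      · simp
    rw [cellIntegral, ← MeasureTheory.integral_congr_ae (Filter.Eventually.of_forall h1), h]
    refine Finset.sum_eq_zero fun j _ => ?_
    rw [sub_eq_zero]
    refine MeasureTheory.integral_congr_ae (Filter.Eventually.of_forall fun x => ?_)
    simp only
    split_ifs with hj
    · have h2 : e (j.insertNth (2 * Real.pi) x) =
          e (j.insertNth ((0 : Fin (m + 1) → ℝ) j) x) +
            (2 * Real.pi) • latticeVec (Pi.single j 1) := by
        ext l
        refine Fin.succAboveCases j ?_ (fun l => ?_) l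
        · simp [he, latticeVec, EuclideanSpace.equiv]
        · simp [he, latticeVec, EuclideanSpace.equiv, Fin.succAbove_ne]
      rw [h2, hper]
    · rfl
  · intro j
    by_cases hj : j = i
    · simp only [hj, if_true]
      exact (hf.continuous.comp e.continuous).continuousOn
    · simp only [hj, if_false]
      exact continuousOn_const
  · intro x _ j
    by_cases hj : j = i
    · simp only [hj, if_true]
      exact ((hf.differentiable one_ne_zero) (e x)).hasFDerivAt.comp x e.hasFDerivAt
    · simp only [hj, if_false]
      exact hasFDerivAt_const _ _
  · refine Continuous.integrableOn_Icc ?_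
    refine continuous_finsetSum _ fun j _ => ?_
    by_cases hj : j = i
    · simp only [hj, if_true]
      exact (hcont.clm_comp continuous_const).clm_apply continuous_const
    · simp only [hj, if_false]
      exact continuous_const

/-- The partial derivative `∂ᵢ` on test functions. -/
def partialDeriv {n : ℕ} (i : Fin n) : PeriodicTestFunction n →ₗ[ℂ] PeriodicTestFunction n where
  toFun φ := ⟨fun x => fderiv ℝ (φ : EuclideanSpace ℝ (Fin n) → ℂ) x (EuclideanSpace.single i 1),
    (φ.2.1.fderiv_right (m := ∞) (by simp)).clm_apply contDiff_const, fun l x => by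
      have h : (fun y => (φ : EuclideanSpace ℝ (Fin n) → ℂ) (y + (2 * Real.pi) • latticeVec l))
          = φ := funext (φ.2.2 l)
      have h2 := fderiv_comp_add_right (𝕜 := ℝ) (f := (φ : EuclideanSpace ℝ (Fin n) → ℂ)) (x := x)
        ((2 * Real.pi) • latticeVec l)
      beta_reduce
      rw [← h2, h]⟩
  map_add' φ ψ := by
    ext x
    have h1 := (φ.2.1.differentiable (by simp)) x
    have h2 := (ψ.2.1.differentiable (by simp)) x
    change fderiv ℝ ((φ : EuclideanSpace ℝ (Fin n) → ℂ) + (ψ : EuclideanSpace ℝ (Fin n) → ℂ)) x _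
      = _
    rw [fderiv_add h1 h2]
    rfl
  map_smul' c φ := by
    ext x
    have h1 := (φ.2.1.differentiable (by simp)) x
    change fderiv ℝ (c • (φ : EuclideanSpace ℝ (Fin n) → ℂ)) x _ = _
    rw [fderiv_const_smul h1]
    rfl

theorem partialDeriv_apply {n : ℕ} (i : Fin n) (φ : PeriodicTestFunction n)
    (x : EuclideanSpace ℝ (Fin n)) :
    (partialDeriv i φ : EuclideanSpace ℝ (Fin n) → ℂ) x =
      fderiv ℝ (φ : EuclideanSpace ℝ (Fin n) → ℂ) x (EuclideanSpace.single i 1) := rfl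

/-- The Laplacian on test functions. -/
def laplaceTest (n : ℕ) : PeriodicTestFunction n →ₗ[ℂ] PeriodicTestFunction n :=
  ∑ i, partialDeriv i ∘ₗ partialDeriv i

theorem coe_finsetSum_test {n : ℕ} {ι : Type*} (s : Finset ι) (f : ι → PeriodicTestFunction n)
    (x : EuclideanSpace ℝ (Fin n)) :
    ((∑ i ∈ s, f i : PeriodicTestFunction n) : EuclideanSpace ℝ (Fin n) → ℂ) x =
      ∑ i ∈ s, (f i : EuclideanSpace ℝ (Fin n) → ℂ) x := by
  rw [Submodule.coe_sum, Finset.sum_apply]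

theorem coe_laplaceTest {n : ℕ} (φ : PeriodicTestFunction n) :
    (laplaceTest n φ : EuclideanSpace ℝ (Fin n) → ℂ) =
      Laplacian.laplacian (φ : EuclideanSpace ℝ (Fin n) → ℂ) := by
  rw [InnerProductSpace.laplacian_eq_iteratedFDeriv_orthonormalBasis _
    (EuclideanSpace.basisFun (Fin n) ℝ)]
  ext x
  rw [laplaceTest, LinearMap.sum_apply, coe_finsetSum_test]
  refine Finset.sum_congr rfl fun i _ => ?_
  rw [LinearMap.comp_apply, partialDeriv_apply, iteratedFDeriv_two_apply]
  have h1 : Differentiable ℝ (fderiv ℝ (φ : EuclideanSpace ℝ (Fin n) → ℂ)) :=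
    (φ.2.1.fderiv_right (m := ∞) (by simp)).differentiable (by simp)
  have h2 : (partialDeriv i φ : EuclideanSpace ℝ (Fin n) → ℂ) =
      fun y => fderiv ℝ (φ : EuclideanSpace ℝ (Fin n) → ℂ) y (EuclideanSpace.single i 1) := rfl
  rw [h2, fderiv_clm_apply (h1 x) (differentiableAt_const _)]
  simp

/-- Linear operators on test functions that are continuous for the `C^∞` topology. -/
def ContinuousOnTests {n : ℕ} (T : PeriodicTestFunction n →ₗ[ℂ] PeriodicTestFunction n) : Prop :=
  ∀ N : ℕ, ∃ (C : ℝ) (N' : ℕ), ∀ (φ : PeriodicTestFunction n) (M : ℝ),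
    (∀ j ≤ N', ∀ x, ‖iteratedFDeriv ℝ j (φ : EuclideanSpace ℝ (Fin n) → ℂ) x‖ ≤ M) →
      ∀ j ≤ N, ∀ x, ‖iteratedFDeriv ℝ j (T φ : EuclideanSpace ℝ (Fin n) → ℂ) x‖ ≤ C * M

namespace ContinuousOnTests

variable {n : ℕ} {S T : PeriodicTestFunction n →ₗ[ℂ] PeriodicTestFunction n}

theorem id : ContinuousOnTests (LinearMap.id : PeriodicTestFunction n →ₗ[ℂ] _) :=
  fun N => ⟨1, N, fun φ M h j hj x => by simpa using h j hj x⟩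

theorem comp (hS : ContinuousOnTests S) (hT : ContinuousOnTests T) :
    ContinuousOnTests (S ∘ₗ T) := by
  intro N
  obtain ⟨C, N', h⟩ := hS N
  obtain ⟨C', N'', h'⟩ := hT N'
  refine ⟨C * C', N'', fun φ M hM j hj x => ?_⟩
  rw [mul_assoc]
  exact h (T φ) (C' * M) (h' φ M hM) j hj x

theorem add (hS : ContinuousOnTests S) (hT : ContinuousOnTests T) :
    ContinuousOnTests (S + T) := by
  intro N
  obtain ⟨C, N', h⟩ := hS N
  obtain ⟨C', N'', h'⟩ := hT N
  refine ⟨C + C', max N' N'', fun φ M hM j hj x => ?_⟩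
  have h1 := h φ M (fun j hj => hM j (hj.trans (le_max_left _ _))) j hj x
  have h2 := h' φ M (fun j hj => hM j (hj.trans (le_max_right _ _))) j hj x
  have h3 := iteratedFDeriv_add_apply (𝕜 := ℝ) (i := j) (x := x)
    ((S φ).2.1.contDiffAt.of_le (by exact_mod_cast le_top))
    ((T φ).2.1.contDiffAt.of_le (by exact_mod_cast le_top))
  change ‖iteratedFDeriv ℝ j ((S φ : EuclideanSpace ℝ (Fin n) → ℂ) +
    (T φ : EuclideanSpace ℝ (Fin n) → ℂ)) x‖ ≤ _
  rw [h3, add_mul]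
  exact (norm_add_le _ _).trans (add_le_add h1 h2)

theorem neg (hT : ContinuousOnTests T) : ContinuousOnTests (-T) := by
  intro N
  obtain ⟨C, N', h⟩ := hT N
  refine ⟨C, N', fun φ M hM j hj x => ?_⟩
  change ‖iteratedFDeriv ℝ j (-(T φ : EuclideanSpace ℝ (Fin n) → ℂ)) x‖ ≤ _
  rw [iteratedFDeriv_neg_apply, norm_neg]
  exact h φ M hM j hj x

theorem zero : ContinuousOnTests (0 : PeriodicTestFunction n →ₗ[ℂ] PeriodicTestFunction n) := by
  refine fun N => ⟨0, 0, fun φ M hM j hj x => ?_⟩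
  change ‖iteratedFDeriv ℝ j (0 : EuclideanSpace ℝ (Fin n) → ℂ) x‖ ≤ _
  simp

theorem sum {ι : Type*} (s : Finset ι)
    {T : ι → PeriodicTestFunction n →ₗ[ℂ] PeriodicTestFunction n}
    (hT : ∀ i, ContinuousOnTests (T i)) : ContinuousOnTests (∑ i ∈ s, T i) := by
  classical
  induction s using Finset.induction_on with
  | empty => simpa using zero
  | insert i s hi ih => rw [Finset.sum_insert hi]; exact (hT i).add ih

theorem pow (hT : ContinuousOnTests T) (m : ℕ) : ContinuousOnTests (T ^ m) := by
  induction m with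
  | zero => exact id
  | succ m ih => rw [pow_succ]; exact ih.comp hT

theorem partialDeriv (i : Fin n) : ContinuousOnTests (partialDeriv i) := by
  refine fun N => ⟨1, N + 1, fun φ M hM j hj x => ?_⟩
  have h1 : ContDiffAt ℝ ∞ (fderiv ℝ (φ : EuclideanSpace ℝ (Fin n) → ℂ)) x :=
    (φ.2.1.fderiv_right (m := ∞) (by simp)).contDiffAt
  have h2 := norm_iteratedFDeriv_clm_apply_const (c := EuclideanSpace.single i (1 : ℝ)) (n := j)
    h1 (by exact_mod_cast le_top)
  rw [norm_iteratedFDeriv_fderiv] at h2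
  have h3 : ‖EuclideanSpace.single i (1 : ℝ)‖ = 1 := by simp
  rw [h3] at h2
  refine h2.trans ?_
  rw [one_mul, one_mul]
  exact hM (j + 1) (by omega) x

theorem laplaceTest : ContinuousOnTests (laplaceTest n) :=
  sum _ fun i => (partialDeriv i).comp (partialDeriv i)

end ContinuousOnTests

/-- The transpose of a continuous operator on test functions. -/
def PeriodicDistribution.precomp {n : ℕ} (u : PeriodicDistribution n)
    {T : PeriodicTestFunction n →ₗ[ℂ] PeriodicTestFunction n} (hT : ContinuousOnTests T) :
    PeriodicDistribution n :=
  ⟨u.1 ∘ₗ T, by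
    obtain ⟨C, N, hu⟩ := u.2
    obtain ⟨C', N', h⟩ := hT N
    refine ⟨C * C', N', fun φ M hM => ?_⟩
    rw [mul_assoc]
    exact hu (T φ) (C' * M) (h φ M hM)⟩

/-! ### Fourier coefficients of test functions -/

theorem norm_sq_latticeVec {n : ℕ} (k : Fin n → ℤ) :
    ‖latticeVec k‖ ^ 2 = ∑ i, (k i : ℝ) ^ 2 := by
  simp [latticeVec, EuclideanSpace.norm_sq_eq]

theorem inner_latticeVec_single {n : ℕ} (k : Fin n → ℤ) (i : Fin n) :
    inner ℝ (latticeVec k) (EuclideanSpace.single i 1) = (k i : ℝ) := by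
  simp [latticeVec, EuclideanSpace.inner_single_right]

theorem partialDeriv_fourierMode {n : ℕ} (k : Fin n → ℤ) (i : Fin n) :
    partialDeriv i (fourierMode k) = ((k i : ℂ) * Complex.I) • fourierMode k := by
  ext x
  have h0 : HasFDerivAt (fun x : EuclideanSpace ℝ (Fin n) => inner ℝ (latticeVec k) x)
      (innerSL ℝ (latticeVec k)) x := (innerSL ℝ (latticeVec k)).hasFDerivAt
  have h1 : HasFDerivAt (fourierMode k : EuclideanSpace ℝ (Fin n) → ℂ) _ x :=
    ((Complex.ofRealCLM.hasFDerivAt.comp x h0).mul_const Complex.I).cexp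
  rw [partialDeriv_apply, h1.fderiv]
  have h2 := inner_latticeVec_single k i
  simp [h2]
  change _ = ((k i : ℂ) * Complex.I) * Complex.exp _
  ring

theorem laplaceTest_fourierMode {n : ℕ} (k : Fin n → ℤ) :
    laplaceTest n (fourierMode k) = (-(‖latticeVec k‖ ^ 2 : ℝ) : ℂ) • fourierMode k := by
  rw [laplaceTest, LinearMap.sum_apply, norm_sq_latticeVec]
  simp only [LinearMap.comp_apply, partialDeriv_fourierMode, map_smul, smul_smul]
  rw [← Finset.sum_smul]
  congr 1
  push_cast
  rw [← Finset.sum_neg_distrib]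
  refine Finset.sum_congr rfl fun i _ => ?_
  linear_combination ((k i : ℂ) ^ 2) * Complex.I_sq

theorem integrableOn_cell {n : ℕ} {f : EuclideanSpace ℝ (Fin n) → ℂ} (hf : Continuous f) :
    MeasureTheory.IntegrableOn (fun x => f (WithLp.toLp 2 x))
      (Set.Icc (0 : Fin n → ℝ) (fun _ => 2 * Real.pi)) :=
  (hf.comp (PiLp.continuous_toLp 2 _)).integrableOn_Icc

/-- The pairing `∫ φ(x) e^{i k·x} dx` over the fundamental cell. -/
def modeIntegral {n : ℕ} (k : Fin n → ℤ) : PeriodicTestFunction n →ₗ[ℂ] ℂ where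
  toFun φ := cellIntegral fun x => (φ : EuclideanSpace ℝ (Fin n) → ℂ) x *
    (fourierMode k : EuclideanSpace ℝ (Fin n) → ℂ) x
  map_add' φ ψ := by
    simp only [cellIntegral, Submodule.coe_add, Pi.add_apply, add_mul]
    exact MeasureTheory.integral_add
      (integrableOn_cell (f := fun x => _ * _)
        (φ.2.1.continuous.mul (fourierMode k).2.1.continuous))
      (integrableOn_cell (f := fun x => _ * _)
        (ψ.2.1.continuous.mul (fourierMode k).2.1.continuous))
  map_smul' c φ := by
    simp only [cellIntegral, Submodule.coe_smul, Pi.smul_apply, smul_eq_mul, mul_assoc,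
      RingHom.id_apply]
    exact MeasureTheory.integral_const_mul _ _

theorem norm_fourierMode {n : ℕ} (k : Fin n → ℤ) (x : EuclideanSpace ℝ (Fin n)) :
    ‖(fourierMode k : EuclideanSpace ℝ (Fin n) → ℂ) x‖ = 1 :=
  Complex.norm_exp_ofReal_mul_I _

theorem modeIntegral_partialDeriv {n : ℕ} (k : Fin n → ℤ) (i : Fin n)
    (φ : PeriodicTestFunction n) :
    modeIntegral k (partialDeriv i φ) = -((k i : ℂ) * Complex.I) * modeIntegral k φ := by
  set e := fourierMode k with he
  have h1 : ContDiff ℝ 1 ((φ : EuclideanSpace ℝ (Fin n) → ℂ) * (e : EuclideanSpace ℝ (Fin n) → ℂ)) :=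
    (φ.2.1.mul e.2.1).of_le (by exact_mod_cast le_top)
  have h2 := cellIntegral_fderiv h1 (fun l x => by
    simp only [Pi.mul_apply]; rw [φ.2.2 l x, e.2.2 l x]) i
  have h3 : ∀ x, fderiv ℝ ((φ : EuclideanSpace ℝ (Fin n) → ℂ) * (e : EuclideanSpace ℝ (Fin n) → ℂ)) x
      (EuclideanSpace.single i 1) =
      (partialDeriv i φ : EuclideanSpace ℝ (Fin n) → ℂ) x * (e : EuclideanSpace ℝ (Fin n) → ℂ) x +
      (((k i : ℂ) * Complex.I) • φ : PeriodicTestFunction n).1 x *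
        (e : EuclideanSpace ℝ (Fin n) → ℂ) x := by
    intro x
    rw [fderiv_mul (φ.2.1.differentiable (by simp) x) (e.2.1.differentiable (by simp) x)]
    have h4 : fderiv ℝ (e : EuclideanSpace ℝ (Fin n) → ℂ) x (EuclideanSpace.single i 1) =
        ((k i : ℂ) * Complex.I) * (e : EuclideanSpace ℝ (Fin n) → ℂ) x := by
      rw [← partialDeriv_apply, he, partialDeriv_fourierMode]; rfl
    have h5 : (((k i : ℂ) * Complex.I) • φ : PeriodicTestFunction n).1 x =
      ((k i : ℂ) * Complex.I) * (φ : EuclideanSpace ℝ (Fin n) → ℂ) x := rfl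
    simp only [_root_.add_apply, _root_.smul_apply, smul_eq_mul, h4, h5,
      partialDeriv_apply]
    ring
  have h6 : cellIntegral (fun x => fderiv ℝ ((φ : EuclideanSpace ℝ (Fin n) → ℂ) *
      (e : EuclideanSpace ℝ (Fin n) → ℂ)) x (EuclideanSpace.single i 1)) =
      modeIntegral k (partialDeriv i φ) + modeIntegral k (((k i : ℂ) * Complex.I) • φ) := by
    simp only [h3]
    exact MeasureTheory.integral_add
      (integrableOn_cell (f := fun x => _ * _)
        ((partialDeriv i φ).2.1.continuous.mul e.2.1.continuous))
      (integrableOn_cell (f := fun x => _ * _)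
        ((((k i : ℂ) * Complex.I) • φ).2.1.continuous.mul e.2.1.continuous))
  rw [h6, map_smul, smul_eq_mul] at h2
  linear_combination h2

theorem modeIntegral_laplaceTest {n : ℕ} (k : Fin n → ℤ) (φ : PeriodicTestFunction n) :
    modeIntegral k (laplaceTest n φ) = -(‖latticeVec k‖ ^ 2 : ℝ) * modeIntegral k φ := by
  rw [laplaceTest, LinearMap.sum_apply, map_sum, norm_sq_latticeVec]
  simp only [LinearMap.comp_apply, modeIntegral_partialDeriv]
  push_cast
  rw [← Finset.sum_neg_distrib, Finset.sum_mul]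
  refine Finset.sum_congr rfl fun i _ => ?_
  linear_combination ((k i : ℂ) ^ 2 * modeIntegral k φ) * Complex.I_sq

theorem fourierMode_mul_neg {n : ℕ} (k : Fin n → ℤ) (x : EuclideanSpace ℝ (Fin n)) :
    (fourierMode (-k) : EuclideanSpace ℝ (Fin n) → ℂ) x *
      (fourierMode k : EuclideanSpace ℝ (Fin n) → ℂ) x = 1 := by
  change Complex.exp _ * Complex.exp _ = 1
  have h : latticeVec (-k) = -latticeVec k := by ext i; simp [latticeVec]
  rw [← Complex.exp_add, h, inner_neg_left]
  simp

theorem volume_cell (n : ℕ) :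
    MeasureTheory.volume.real (Set.Icc (0 : Fin n → ℝ) (fun _ => 2 * Real.pi)) =
      (2 * Real.pi) ^ n := by
  rw [MeasureTheory.measureReal_def, Real.volume_Icc_pi_toReal (fun _ => by positivity)]
  simp

theorem modeIntegral_fourierMode_self {n : ℕ} (k : Fin n → ℤ) :
    modeIntegral k (fourierMode (-k)) = (2 * Real.pi) ^ n := by
  change cellIntegral (fun x => (fourierMode (-k) : EuclideanSpace ℝ (Fin n) → ℂ) x *
    (fourierMode k : EuclideanSpace ℝ (Fin n) → ℂ) x) = _
  simp only [fourierMode_mul_neg, cellIntegral, MeasureTheory.setIntegral_const, volume_cell]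
  simp

/-- Integration by parts evaluates the pairing with `∂ᵢ e^{-i l·x}` in two ways, giving `(kᵢ - lᵢ) I
= 0` for the integral `I`; no explicit integral is needed. -/
theorem modeIntegral_fourierMode_of_ne {n : ℕ} {k l : Fin n → ℤ} (h : k ≠ l) :
    modeIntegral k (fourierMode (-l)) = 0 := by
  obtain ⟨i, hi⟩ := Function.ne_iff.1 h
  have h1 := modeIntegral_partialDeriv k i (fourierMode (-l))
  rw [partialDeriv_fourierMode, map_smul, smul_eq_mul] at h1
  have h2 : ((k i - l i : ℤ) : ℂ) * Complex.I * modeIntegral k (fourierMode (-l)) = 0 := by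
    push_cast [Pi.neg_apply] at h1 ⊢
    linear_combination h1
  simpa [sub_eq_zero, hi] using h2

theorem norm_modeIntegral_le {n : ℕ} (k : Fin n → ℤ) (φ : PeriodicTestFunction n) {M : ℝ}
    (hM : ∀ x ∈ Set.Icc (0 : Fin n → ℝ) (fun _ => 2 * Real.pi),
      ‖(φ : EuclideanSpace ℝ (Fin n) → ℂ) (WithLp.toLp 2 x)‖ ≤ M) :
    ‖modeIntegral k φ‖ ≤ (2 * Real.pi) ^ n * M := by
  have h := MeasureTheory.norm_setIntegral_le_of_norm_le_const
    (μ := MeasureTheory.volume) (s := Set.Icc (0 : Fin n → ℝ) (fun _ => 2 * Real.pi))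
    (f := fun x => (φ : EuclideanSpace ℝ (Fin n) → ℂ) (WithLp.toLp 2 x) *
      (fourierMode k : EuclideanSpace ℝ (Fin n) → ℂ) (WithLp.toLp 2 x)) (C := M)
    (isCompact_Icc.measure_lt_top) (fun x hx => by
      rw [norm_mul, norm_fourierMode, mul_one]; exact hM x hx)
  rw [volume_cell, mul_comm] at h
  exact h

theorem modeIntegral_pow {n : ℕ} (k : Fin n → ℤ) (m : ℕ) (φ : PeriodicTestFunction n) :
    modeIntegral k (((1 + -laplaceTest n : Module.End ℂ _) ^ m) φ) =
      ((1 + ‖latticeVec k‖ ^ 2) ^ m : ℝ) * modeIntegral k φ := by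
  induction m generalizing φ with
  | zero => simp
  | succ m ih =>
    rw [pow_succ, Module.End.mul_apply, ih, LinearMap.add_apply, LinearMap.neg_apply, map_add,
      map_neg, modeIntegral_laplaceTest, Module.End.one_apply]
    push_cast
    ring

/-- The weight comes from moving `(1 - Δ)ᵐ` onto `φ`. Uniformity of `C` and `N` in `φ` is what later
makes a Fourier series a continuous functional. -/
theorem exists_norm_modeIntegral_le (n m : ℕ) : ∃ (C : ℝ) (N : ℕ),
    ∀ (φ : PeriodicTestFunction n) (M : ℝ),
      (∀ j ≤ N, ∀ x, ‖iteratedFDeriv ℝ j (φ : EuclideanSpace ℝ (Fin n) → ℂ) x‖ ≤ M) →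
        ∀ k, (1 + ‖latticeVec k‖ ^ 2) ^ m * ‖modeIntegral k φ‖ ≤ C * M := by
  have hT : ContinuousOnTests ((1 + -laplaceTest n : Module.End ℂ _) ^ m) :=
    (ContinuousOnTests.id.add ContinuousOnTests.laplaceTest.neg).pow m
  obtain ⟨C, N, h⟩ := hT 0
  refine ⟨(2 * Real.pi) ^ n * |C|, N, fun φ M hM k => ?_⟩
  have hM0 : 0 ≤ M := (norm_nonneg _).trans (hM 0 (Nat.zero_le _) 0)
  have h1 := norm_modeIntegral_le k (((1 + -laplaceTest n : Module.End ℂ _) ^ m) φ) (M := C * M)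
    (fun x _ => by simpa using h φ M hM 0 le_rfl (WithLp.toLp 2 x))
  rw [modeIntegral_pow, norm_mul, Complex.norm_real, Real.norm_eq_abs,
    abs_of_nonneg (by positivity)] at h1
  refine h1.trans ?_
  rw [mul_assoc]
  gcongr
  exact le_abs_self C

/-! ### Distributions with prescribed Fourier coefficients -/

theorem exists_summable_inv_pow (n : ℕ) :
    ∃ m : ℕ, Summable fun k : Fin n → ℤ => ((1 + ‖latticeVec k‖ ^ 2) ^ m)⁻¹ := by
  set b := (EuclideanSpace.basisFun (Fin n) ℝ).toBasis
  set L := Submodule.span ℤ (Set.range b)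
  set m := Module.finrank ℤ L + 1 with hm
  have hs := ZLattice.summable_norm_pow_inv L (2 * m) (by omega)
  have hmem : ∀ k : Fin n → ℤ, latticeVec k ∈ L := by
    intro k
    have : latticeVec k = ∑ i, k i • b i := by
      ext j
      simp [latticeVec, b, Pi.single_apply]
    rw [this]
    exact Submodule.sum_mem _ fun i _ => Submodule.smul_mem _ _ (Submodule.subset_span ⟨i, rfl⟩)
  have hinj : Function.Injective fun k : Fin n → ℤ => (⟨latticeVec k, hmem k⟩ : L) := by
    intro k l h
    have h1 : latticeVec k = latticeVec l := congrArg Subtype.val h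
    ext i
    have h2 := congrFun (congrArg WithLp.ofLp h1) i
    simpa [latticeVec] using h2
  refine ⟨m, Summable.of_norm_bounded_eventually (hs.comp_injective hinj) ?_⟩
  -- The comparison fails at `k = 0`, where the inverse norm is `0` by convention.
  have h0 : ∀ᶠ k : Fin n → ℤ in Filter.cofinite, k ≠ 0 :=
    (Set.finite_singleton (0 : Fin n → ℤ)).subset (by intro k; simp)
  filter_upwards [h0] with k hk
  have hk0 : 0 < ‖latticeVec k‖ := by
    rw [norm_pos_iff]
    intro h
    refine hk (hinj (Subtype.ext ?_))
    simp only [h]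
    ext i; simp [latticeVec]
  rw [Real.norm_eq_abs, abs_of_nonneg (by positivity), Function.comp_apply]
  change _ ≤ ‖latticeVec k‖⁻¹ ^ (2 * m)
  rw [inv_pow, pow_mul]
  gcongr
  simp

/-- A multi-sequence of polynomial growth is the sequence of Fourier coefficients of a
distribution. -/
theorem exists_fourierCoeffDist_eq {n : ℕ} (c : (Fin n → ℤ) → ℂ) (A : ℝ) (P : ℕ)
    (hc : ∀ k, ‖c k‖ ≤ A * (1 + ‖latticeVec k‖ ^ 2) ^ P) :
    ∃ u : PeriodicDistribution n, ∀ k, fourierCoeffDist u k = c k := by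
  obtain ⟨m, hm⟩ := exists_summable_inv_pow n
  -- `P` powers absorb the growth of `c`; the remaining `m` make the series summable.
  obtain ⟨C, N, hC⟩ := exists_norm_modeIntegral_le n (P + m)
  have hA : 0 ≤ A := by
    have h := (norm_nonneg _).trans (hc 0)
    exact nonneg_of_mul_nonneg_left h (by positivity)
  have hdecay : ∀ (φ : PeriodicTestFunction n) (k : Fin n → ℤ) {D : ℝ},
      (1 + ‖latticeVec k‖ ^ 2) ^ (P + m) * ‖modeIntegral k φ‖ ≤ D →
      ‖c k * modeIntegral k φ‖ ≤ A * D * ((1 + ‖latticeVec k‖ ^ 2) ^ m)⁻¹ := by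
    intro φ k D h1
    have h2 : 0 < (1 + ‖latticeVec k‖ ^ 2) ^ m := by positivity
    rw [norm_mul, ← div_eq_mul_inv, le_div_iff₀ h2]
    calc ‖c k‖ * ‖modeIntegral k φ‖ * (1 + ‖latticeVec k‖ ^ 2) ^ m
        ≤ A * (1 + ‖latticeVec k‖ ^ 2) ^ P * ‖modeIntegral k φ‖ * (1 + ‖latticeVec k‖ ^ 2) ^ m := by
          gcongr; exact hc k
      _ = A * ((1 + ‖latticeVec k‖ ^ 2) ^ (P + m) * ‖modeIntegral k φ‖) := by ring
      _ ≤ A * D := by gcongr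
  -- For a fixed `φ` it suffices to bound `(1 - Δ)^(P+m) φ` on the compact cell; the seminorm
  -- estimate `hC` is kept for continuity in `φ`.
  have hbdd : ∀ φ : PeriodicTestFunction n, ∃ M : ℝ, ∀ k,
      ‖c k * modeIntegral k φ‖ ≤ M * ((1 + ‖latticeVec k‖ ^ 2) ^ m)⁻¹ := by
    intro φ
    set ψ := ((1 + -laplaceTest n : Module.End ℂ _) ^ (P + m)) φ with hψ
    obtain ⟨M, hM⟩ := (isCompact_Icc (a := (0 : Fin n → ℝ))
      (b := fun _ => 2 * Real.pi)).exists_bound_of_continuousOn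
        (f := fun x => (ψ : EuclideanSpace ℝ (Fin n) → ℂ) (WithLp.toLp 2 x))
        (ψ.2.1.continuous.comp (PiLp.continuous_toLp 2 _)).continuousOn
    refine ⟨A * ((2 * Real.pi) ^ n * M), fun k => hdecay φ k ?_⟩
    have h1 := norm_modeIntegral_le k ψ hM
    rwa [hψ, modeIntegral_pow, norm_mul, Complex.norm_real, Real.norm_eq_abs,
      abs_of_nonneg (by positivity)] at h1
  have hsum : ∀ φ : PeriodicTestFunction n, Summable fun k => c k * modeIntegral k φ := by
    intro φ
    obtain ⟨M, hM⟩ := hbdd φ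
    exact Summable.of_norm_bounded (hm.mul_left M) hM
  refine ⟨⟨⟨⟨fun φ => ∑' k, c k * modeIntegral k φ, fun φ ψ => ?_⟩, fun a φ => ?_⟩,
    A * C * ∑' k : Fin n → ℤ, ((1 + ‖latticeVec k‖ ^ 2) ^ m)⁻¹, N, fun φ M hM => ?_⟩, fun k => ?_⟩
  · rw [← (hsum φ).tsum_add (hsum ψ)]
    exact tsum_congr fun k => by rw [map_add, mul_add]
  · rw [RingHom.id_apply, smul_eq_mul, ← tsum_mul_left]
    exact tsum_congr fun k => by rw [map_smul, smul_eq_mul]; ring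
  · have h := tsum_of_norm_bounded (hm.mul_left (A * (C * M))).hasSum
      fun k => hdecay φ k (hC φ M hM k)
    rw [tsum_mul_left] at h
    refine h.trans_eq (by ring)
  · change ((2 * Real.pi) ^ n : ℂ)⁻¹ * ∑' l, c l * modeIntegral l (fourierMode (-k)) = c k
    rw [tsum_eq_single k fun l hl => by rw [modeIntegral_fourierMode_of_ne hl, mul_zero],
      modeIntegral_fourierMode_self]
    have : (2 * Real.pi : ℂ) ^ n ≠ 0 := pow_ne_zero _ (by simp [Real.pi_ne_zero])
    field_simp

/-! ### Sobolev norms and Fourier multipliers -/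

section Coefficients

variable {n : ℕ}

theorem fourierCoeffDist_add (u v : PeriodicDistribution n) (k : Fin n → ℤ) :
    fourierCoeffDist (u + v) k = fourierCoeffDist u k + fourierCoeffDist v k :=
  mul_add _ _ _

theorem fourierCoeffDist_smul (c : ℂ) (u : PeriodicDistribution n) (k : Fin n → ℤ) :
    fourierCoeffDist (c • u) k = c * fourierCoeffDist u k :=
  mul_left_comm _ _ _

theorem fourierCoeffDist_sub (u v : PeriodicDistribution n) (k : Fin n → ℤ) :
    fourierCoeffDist (u - v) k = fourierCoeffDist u k - fourierCoeffDist v k :=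
  mul_sub _ _ _

theorem fourierCoeffDist_zero (k : Fin n → ℤ) :
    fourierCoeffDist (0 : PeriodicDistribution n) k = 0 :=
  mul_zero _

/-- One term is at most the whole sum. Each coefficient is thus continuous on every `H^q`, so time
derivatives can be read mode by mode. -/
theorem MemSobolev.norm_coeff_le {q : ℝ} {u : PeriodicDistribution n} (hu : MemSobolev q u)
    (k : Fin n → ℤ) :
    ‖fourierCoeffDist u k‖ ≤ (1 + ‖latticeVec k‖ ^ 2) ^ (-(q / 2)) * sobolevNorm q u := by
  have hw : 0 < 1 + ‖latticeVec k‖ ^ 2 := by positivity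
  have h1 : (1 + ‖latticeVec k‖ ^ 2) ^ q * ‖fourierCoeffDist u k‖ ^ 2 ≤ _ :=
    hu.le_tsum k fun j _ => by positivity
  have h2 : ((1 + ‖latticeVec k‖ ^ 2) ^ (q / 2) * ‖fourierCoeffDist u k‖) ^ 2 =
      (1 + ‖latticeVec k‖ ^ 2) ^ q * ‖fourierCoeffDist u k‖ ^ 2 := by
    rw [mul_pow, ← Real.rpow_mul_natCast hw.le]; norm_num
  rw [← h2] at h1
  have h3 := Real.le_sqrt_of_sq_le h1
  rw [Real.rpow_neg hw.le, ← div_eq_inv_mul, le_div_iff₀ (Real.rpow_pos_of_pos hw _), mul_comm]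
  exact h3

theorem MemSobolev.exists_polynomial_bound {q : ℝ} {u : PeriodicDistribution n}
    (hu : MemSobolev q u) : ∃ (A : ℝ) (P : ℕ), 0 ≤ A ∧
      ∀ k, ‖fourierCoeffDist u k‖ ≤ A * (1 + ‖latticeVec k‖ ^ 2) ^ P := by
  refine ⟨sobolevNorm q u, ⌈-(q / 2)⌉₊, Real.sqrt_nonneg _, fun k => ?_⟩
  refine (hu.norm_coeff_le k).trans ?_
  rw [mul_comm]
  refine mul_le_mul_of_nonneg_left ?_ (Real.sqrt_nonneg _)
  rw [← Real.rpow_natCast (1 + ‖latticeVec k‖ ^ 2)]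
  exact Real.rpow_le_rpow_of_exponent_le (le_add_of_nonneg_right (sq_nonneg _)) (Nat.le_ceil _)

theorem weighted_term_eq {σ r f : ℝ} {u b : PeriodicDistribution n} {k : Fin n → ℤ}
    (h : fourierCoeffDist u k = f * fourierCoeffDist b k) :
    (1 + ‖latticeVec k‖ ^ 2) ^ (σ + 2 * r) * ‖fourierCoeffDist u k‖ ^ 2 =
      ((1 + ‖latticeVec k‖ ^ 2) ^ r * f) ^ 2 *
        ((1 + ‖latticeVec k‖ ^ 2) ^ σ * ‖fourierCoeffDist b k‖ ^ 2) := by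
  have hw : 0 < 1 + ‖latticeVec k‖ ^ 2 := by positivity
  rw [h, norm_mul, Complex.norm_real, mul_pow, Real.norm_eq_abs, sq_abs, Real.rpow_add hw,
    mul_comm 2 r, Real.rpow_mul hw.le, Real.rpow_two]
  ring

theorem MemSobolev.of_multiplier {σ r C : ℝ} {f : (Fin n → ℤ) → ℝ}
    {u b : PeriodicDistribution n} (hb : MemSobolev σ b)
    (hu : ∀ k, fourierCoeffDist u k = f k * fourierCoeffDist b k)
    (hf : ∀ k, |(1 + ‖latticeVec k‖ ^ 2) ^ r * f k| ≤ C) : MemSobolev (σ + 2 * r) u := by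
  refine Summable.of_nonneg_of_le (fun k => by positivity) (fun k => ?_) (hb.mul_left (C ^ 2))
  rw [weighted_term_eq (hu k)]
  exact mul_le_mul_of_nonneg_right (sq_le_sq' (abs_le.1 (hf k)).1 (abs_le.1 (hf k)).2)
    (by positivity)

/-- Dominated convergence over the frequencies, with `C²` times the summand of `‖b‖²` in `H^σ` as
majorant. -/
theorem tendsto_sobolevNorm_of_multiplier {ι : Type*} {l : Filter ι} {σ r C : ℝ}
    {f : ι → (Fin n → ℤ) → ℝ} {u : ι → PeriodicDistribution n} {b : PeriodicDistribution n}
    (hb : MemSobolev σ b)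
    (hu : ∀ᶠ i in l, ∀ k, fourierCoeffDist (u i) k = f i k * fourierCoeffDist b k)
    (hf : ∀ᶠ i in l, ∀ k, |(1 + ‖latticeVec k‖ ^ 2) ^ r * f i k| ≤ C)
    (hf0 : ∀ k, Filter.Tendsto (fun i => f i k) l (𝓝 0)) :
    Filter.Tendsto (fun i => sobolevNorm (σ + 2 * r) (u i)) l (𝓝 0) := by
  have h : Filter.Tendsto (fun i => ∑' k : Fin n → ℤ,
      ((1 + ‖latticeVec k‖ ^ 2) ^ r * f i k) ^ 2 *
        ((1 + ‖latticeVec k‖ ^ 2) ^ σ * ‖fourierCoeffDist b k‖ ^ 2)) l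
      (𝓝 (∑' _ : Fin n → ℤ, 0)) := by
    refine tendsto_tsum_of_dominated_convergence (hb.mul_left (C ^ 2)) (fun k => ?_) ?_
    · have := (((hf0 k).const_mul ((1 + ‖latticeVec k‖ ^ 2) ^ r)).pow 2).mul_const
        ((1 + ‖latticeVec k‖ ^ 2) ^ σ * ‖fourierCoeffDist b k‖ ^ 2)
      simpa using this
    · filter_upwards [hf] with i hi k
      rw [Real.norm_eq_abs, abs_of_nonneg (by positivity)]
      exact mul_le_mul_of_nonneg_right (sq_le_sq' (abs_le.1 (hi k)).1 (abs_le.1 (hi k)).2)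
        (by positivity)
  have h2 := (Real.continuous_sqrt.tendsto _).comp h
  rw [tsum_zero, Real.sqrt_zero] at h2
  refine h2.congr' ?_
  filter_upwards [hu] with i hi
  simp only [Function.comp_apply, sobolevNorm]
  congr 1
  exact tsum_congr fun k => (weighted_term_eq (hi k)).symm

theorem MemSobolev.sub {q : ℝ} {u v : PeriodicDistribution n} (hu : MemSobolev q u)
    (hv : MemSobolev q v) : MemSobolev q (u - v) := by
  refine Summable.of_nonneg_of_le (fun k => by positivity) (fun k => ?_)
    ((hu.add hv).mul_left 2)
  have hw : 0 ≤ (1 + ‖latticeVec k‖ ^ 2) ^ q := by positivity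
  have h1 := norm_sub_le (fourierCoeffDist u k) (fourierCoeffDist v k)
  have h2 : ‖fourierCoeffDist (u - v) k‖ ^ 2 ≤
      2 * (‖fourierCoeffDist u k‖ ^ 2 + ‖fourierCoeffDist v k‖ ^ 2) := by
    rw [fourierCoeffDist_sub]
    nlinarith [norm_nonneg (fourierCoeffDist u k - fourierCoeffDist v k),
      sq_nonneg (‖fourierCoeffDist u k‖ - ‖fourierCoeffDist v k‖)]
  nlinarith [mul_le_mul_of_nonneg_left h2 hw]

theorem MemSobolev.smul {q : ℝ} {u : PeriodicDistribution n} (hu : MemSobolev q u) (c : ℂ) :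
    MemSobolev q (c • u) := by
  refine (Summable.mul_left (‖c‖ ^ 2) hu).congr fun k => ?_
  rw [fourierCoeffDist_smul, norm_mul]
  ring

end Coefficients

/-! ### Forced wave equations with diagonal operators -/

section Wave

variable {n : ℕ}

theorem IsTimeDeriv.hasDerivWithinAt_coeff {q : ℝ} {U V : ℝ → PeriodicDistribution n}
    (h : IsTimeDeriv q U V) (k : Fin n → ℤ) {t : ℝ} (ht : 0 ≤ t) :
    HasDerivWithinAt (fun s => fourierCoeffDist (U s) k) (fourierCoeffDist (V t) k)
      (Set.Ici 0) t := by
  obtain ⟨hU, hV, hlim⟩ := h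
  rw [hasDerivWithinAt_iff_tendsto_slope]
  have hshift : Filter.Tendsto (fun y : ℝ => y - t) (𝓝[Set.Ici 0 \ {t}] t)
      (𝓝[{h : ℝ | h ≠ 0 ∧ 0 ≤ t + h}] 0) := by
    refine tendsto_nhdsWithin_iff.2 ⟨?_, ?_⟩
    · refine Filter.Tendsto.mono_left ?_ nhdsWithin_le_nhds
      simpa using (continuous_sub_right t).tendsto t
    · filter_upwards [self_mem_nhdsWithin] with y hy
      refine ⟨sub_ne_zero.2 hy.2, ?_⟩
      simpa using hy.1
  have h0 : Filter.Tendsto (fun h : ℝ =>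
      fourierCoeffDist (((h : ℂ)⁻¹) • (U (t + h) - U t) - V t) k)
      (𝓝[{h : ℝ | h ≠ 0 ∧ 0 ≤ t + h}] 0) (𝓝 0) := by
    have hz := (hlim t ht).const_mul ((1 + ‖latticeVec k‖ ^ 2) ^ (-(q / 2)))
    rw [mul_zero] at hz
    refine squeeze_zero_norm' ?_ hz
    filter_upwards [self_mem_nhdsWithin] with h hh
    exact ((((hU _ hh.2).sub (hU t ht)).smul _).sub (hV t ht)).norm_coeff_le k
  have h1 := (h0.comp hshift).add_const (fourierCoeffDist (V t) k)
  rw [zero_add] at h1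
  refine h1.congr fun y => ?_
  simp only [Function.comp_apply, fourierCoeffDist_sub, fourierCoeffDist_smul,
    add_sub_cancel, sub_add_cancel, slope_def_module, Complex.real_smul]
  push_cast
  rfl

/-- The difference from the explicit coefficient solves the homogeneous oscillator with zero data,
so it vanishes whatever `q` is. -/
theorem SolvesForcedWave.coeff_eq {A : PeriodicDistribution n → PeriodicDistribution n → Prop}
    {q : ℝ} {b : PeriodicDistribution n} {U : ℝ → PeriodicDistribution n}
    (h : SolvesForcedWave A q b U) {lam : (Fin n → ℤ) → ℝ} (hlam : ∀ k, 0 ≤ lam k)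
    (hA : ∀ u w, A u w → ∀ k, fourierCoeffDist w k = -(lam k : ℂ) * fourierCoeffDist u k)
    {t : ℝ} (ht : 0 ≤ t) (k : Fin n → ℤ) :
    fourierCoeffDist (U t) k = (waveKernel (lam k) t : ℂ) * fourierCoeffDist b k := by
  obtain ⟨V, W, hUV, hVW, heq, hU0, hV0⟩ := h
  rw [← sub_eq_zero]
  refine oscillator_unique (hlam k)
    (d := fun t => fourierCoeffDist (U t) k - (waveKernel (lam k) t : ℂ) * fourierCoeffDist b k)
    (d1 := fun t => fourierCoeffDist (V t) k -
      (waveVelocity (lam k) t : ℂ) * fourierCoeffDist b k)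
    (d2 := fun t => fourierCoeffDist (W t) k -
      (Real.cos (√(lam k) * t) : ℂ) * fourierCoeffDist b k)
    (fun t ht => ?_) (fun t ht => ?_) (fun t ht => ?_) ?_ ?_ ht
  · exact (hUV.hasDerivWithinAt_coeff k ht).sub
      (((hasDerivAt_waveKernel (hlam k) t).ofReal_comp.mul_const _).hasDerivWithinAt)
  · exact (hVW.hasDerivWithinAt_coeff k ht).sub
      (((hasDerivAt_waveVelocity (lam k) t).ofReal_comp.mul_const _).hasDerivWithinAt)
  · obtain ⟨w, hw, hW⟩ := heq t ht
    have h1 : ((lam k * waveKernel (lam k) t : ℝ) : ℂ) =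
        ((1 - Real.cos (√(lam k) * t) : ℝ) : ℂ) := by rw [mul_waveKernel (hlam k)]
    push_cast at h1
    simp only [hW, fourierCoeffDist_add, hA _ _ hw k, Complex.ofReal_cos, Complex.ofReal_mul]
    linear_combination (-fourierCoeffDist b k) * h1
  · simp [hU0, fourierCoeffDist_zero, waveKernel_zero_right]
  · simp [hV0, fourierCoeffDist_zero, waveVelocity_zero_right]

theorem isTimeDeriv_of_multiplier {σ : ℝ} {b : PeriodicDistribution n} (hb : MemSobolev σ b)
    {U V : ℝ → PeriodicDistribution n} {f g : (Fin n → ℤ) → ℝ → ℝ}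
    (hU : ∀ t k, fourierCoeffDist (U t) k = f k t * fourierCoeffDist b k)
    (hV : ∀ t k, fourierCoeffDist (V t) k = g k t * fourierCoeffDist b k)
    (hfg : ∀ k t, HasDerivAt (f k) (g k t) t)
    (hf : ∀ t, ∃ C, ∀ k, |f k t| ≤ C) (hg : ∀ t, ∃ C, ∀ k, |g k t| ≤ C)
    (hlip : ∀ t, ∃ C, ∀ k s, |s| ≤ 1 → |f k (t + s) - f k t| ≤ C * |s|) :
    IsTimeDeriv σ U V := by
  have hmem : ∀ {u : PeriodicDistribution n} {f : (Fin n → ℤ) → ℝ},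
      (∀ k, fourierCoeffDist u k = f k * fourierCoeffDist b k) → (∃ C, ∀ k, |f k| ≤ C) →
      MemSobolev σ u := by
    rintro u f hu ⟨C, hC⟩
    simpa using MemSobolev.of_multiplier (r := 0) (C := C) hb hu (by simpa using hC)
  refine ⟨fun t _ => hmem (hU t) (hf t), fun t _ => hmem (hV t) (hg t), fun t _ => ?_⟩
  obtain ⟨C, hC⟩ := hlip t
  obtain ⟨D, hD⟩ := hg t
  have h := tendsto_sobolevNorm_of_multiplier (r := 0) (C := C + D)
    (l := 𝓝[{h : ℝ | h ≠ 0 ∧ 0 ≤ t + h}] 0)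
    (f := fun h k => h⁻¹ * (f k (t + h) - f k t) - g k t)
    (u := fun h : ℝ => ((h : ℂ)⁻¹) • (U (t + h) - U t) - V t) hb ?_ ?_ ?_
  · simpa using h
  · refine Filter.Eventually.of_forall fun h k => ?_
    simp only [fourierCoeffDist_sub, fourierCoeffDist_smul, hU, hV]
    push_cast
    ring
  · have h1 : ∀ᶠ h : ℝ in 𝓝 0, |h| ≤ 1 := by
      filter_upwards [Metric.closedBall_mem_nhds (0 : ℝ) one_pos] with h hh
      simpa using hh
    filter_upwards [self_mem_nhdsWithin, nhdsWithin_le_nhds h1] with h hh hh1 k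
    rw [Real.rpow_zero, one_mul]
    refine (abs_sub _ _).trans (add_le_add ?_ (hD k))
    rw [abs_mul, abs_inv, inv_mul_le_iff₀ (abs_pos.2 hh.1), mul_comm]
    exact hC k h hh1
  · intro k
    have h1 := (hasDerivAt_iff_tendsto_slope_zero.1 (hfg k t)).sub_const (g k t)
    rw [sub_self] at h1
    exact (h1.mono_left (nhdsWithin_mono _ fun h hh => hh.1))

theorem exists_family_fourierCoeffDist_eq {σ : ℝ} {b : PeriodicDistribution n}
    (hb : MemSobolev σ b) {f : (Fin n → ℤ) → ℝ → ℝ} (hf : ∀ t, ∃ C, ∀ k, |f k t| ≤ C)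
    (hf0 : ∀ k, f k 0 = 0) : ∃ U : ℝ → PeriodicDistribution n, U 0 = 0 ∧
      ∀ t k, fourierCoeffDist (U t) k = f k t * fourierCoeffDist b k := by
  obtain ⟨A, P, hA, hP⟩ := hb.exists_polynomial_bound
  have h : ∀ t, ∃ u : PeriodicDistribution n,
      ∀ k, fourierCoeffDist u k = f k t * fourierCoeffDist b k := by
    intro t
    obtain ⟨C, hC⟩ := hf t
    refine exists_fourierCoeffDist_eq _ (C * A) P fun k => ?_
    rw [norm_mul, Complex.norm_real, mul_assoc]
    exact mul_le_mul (hC k) (hP k) (norm_nonneg _) ((abs_nonneg _).trans (hC k))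
  choose U hU using h
  -- The choice of `U` prescribes coefficients only; setting the value at `0` by hand makes it the
  -- zero distribution without invoking injectivity of the Fourier transform.
  refine ⟨fun t => if t = 0 then 0 else U t, by simp, fun t k => ?_⟩
  by_cases ht : t = 0
  · simp [ht, hf0, fourierCoeffDist_zero]
  · simp [ht, hU]

/-- The operator need only be defined where `|λ_k û_k| ≤ 2 |b̂_k|`, because `λ w = 1 - cos (√λ t)`
lies in `[0, 2]`. No upper bound on the symbol is then required. -/
theorem exists_solvesForcedWave {A : PeriodicDistribution n → PeriodicDistribution n → Prop}
    {σ : ℝ} {b : PeriodicDistribution n} (hb : MemSobolev σ b) {lam : (Fin n → ℤ) → ℝ}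
    (hlam : ∀ k, 0 ≤ lam k)
    (hA : ∀ u, (∀ k, ‖(lam k : ℂ) * fourierCoeffDist u k‖ ≤ 2 * ‖fourierCoeffDist b k‖) →
      ∃ w, A u w ∧ ∀ k, fourierCoeffDist w k = -(lam k : ℂ) * fourierCoeffDist u k) :
    ∃ U, SolvesForcedWave A σ b U := by
  have hbU : ∀ t, ∃ C, ∀ k, |waveKernel (lam k) t| ≤ C := fun t => ⟨t ^ 2 / 2, fun k => by
    rw [abs_of_nonneg (waveKernel_nonneg _ _)]; exact waveKernel_le _ _⟩
  have hbV : ∀ t, ∃ C, ∀ k, |waveVelocity (lam k) t| ≤ C :=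
    fun t => ⟨|t|, fun k => abs_waveVelocity_le _ _⟩
  obtain ⟨U, hU0, hU⟩ := exists_family_fourierCoeffDist_eq hb hbU
    fun k => waveKernel_zero_right _
  obtain ⟨V, hV0, hV⟩ := exists_family_fourierCoeffDist_eq hb hbV
    fun k => waveVelocity_zero_right _
  have hw : ∀ t, ∃ w, A (U t) w ∧
      ∀ k, fourierCoeffDist w k = -(lam k : ℂ) * fourierCoeffDist (U t) k := by
    refine fun t => hA _ fun k => ?_
    rw [hU, ← mul_assoc, ← Complex.ofReal_mul, mul_waveKernel (hlam k), norm_mul,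
      Complex.norm_real, Real.norm_eq_abs]
    gcongr
    rw [abs_le]
    constructor <;>
      linarith [Real.neg_one_le_cos (√(lam k) * t), Real.cos_le_one (√(lam k) * t)]
  choose w hAw hw using hw
  have hW : ∀ t k, fourierCoeffDist (w t + b) k =
      (Real.cos (√(lam k) * t) : ℂ) * fourierCoeffDist b k := by
    intro t k
    have h1 : ((lam k * waveKernel (lam k) t : ℝ) : ℂ) =
        ((1 - Real.cos (√(lam k) * t) : ℝ) : ℂ) := by rw [mul_waveKernel (hlam k)]
    push_cast at h1
    rw [fourierCoeffDist_add, hw, hU]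
    push_cast
    linear_combination (-fourierCoeffDist b k) * h1
  refine ⟨U, V, fun t => w t + b, ?_, ?_, fun t _ => ⟨w t, hAw t, rfl⟩, hU0, hV0⟩
  · exact isTimeDeriv_of_multiplier hb hU hV (fun k t => hasDerivAt_waveKernel (hlam k) t) hbU hbV
      fun t => ⟨|t| + 1, fun k s hs => abs_waveKernel_sub_le (hlam k) hs⟩
  · exact isTimeDeriv_of_multiplier hb hV hW (fun k t => hasDerivAt_waveVelocity (lam k) t) hbV
      (fun t => ⟨1, fun k => Real.abs_cos_le_one _⟩)
      fun t => ⟨1, fun k s _ => by rw [one_mul]; exact abs_waveVelocity_sub_le _ _ _⟩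

theorem IsClassicalLaplacian.coeff_eq {u w : PeriodicDistribution n}
    (h : IsClassicalLaplacian u w) (k : Fin n → ℤ) :
    fourierCoeffDist w k = -((‖latticeVec k‖ ^ 2 : ℝ) : ℂ) * fourierCoeffDist u k := by
  have h1 : ‖latticeVec (-k)‖ = ‖latticeVec k‖ := by
    rw [← norm_neg (latticeVec k)]
    congr 1
    ext i; simp [latticeVec]
  have h2 := h (fourierMode (-k)) (laplaceTest n (fourierMode (-k))) (coe_laplaceTest _)
  rw [laplaceTest_fourierMode, map_smul, h1, smul_eq_mul] at h2
  rw [fourierCoeffDist, fourierCoeffDist, h2]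
  push_cast
  ring

theorem exists_isClassicalLaplacian (u : PeriodicDistribution n) :
    ∃ w, IsClassicalLaplacian u w := by
  refine ⟨PeriodicDistribution.precomp u ContinuousOnTests.laplaceTest, fun φ ψ h => ?_⟩
  have : ψ = laplaceTest n φ := Subtype.ext (h.trans (coe_laplaceTest φ).symm)
  rw [this]
  rfl

/-! ### The nonlocal symbol: growth and limit -/

/-- The nonnegative symbol of `-L^{δ,β}`. -/
def nonlocalSymbol (δ β : ℝ) (k : Fin n → ℤ) : ℝ :=
  ‖latticeVec k‖ ^ 2 * symbolSum (n / 2) ((n + 2 - β) / 2) (δ ^ 2 / 4 * ‖latticeVec k‖ ^ 2)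

theorem nonlocalMultiplier_eq (δ β : ℝ) (k : Fin n → ℤ) :
    nonlocalMultiplier δ β (latticeVec k) = -nonlocalSymbol δ β k := by
  rw [nonlocalMultiplier, nonlocalSymbol, symbolSum]
  ring_nf

theorem nonlocalSymbol_nonneg (hn : 1 ≤ n) {δ β : ℝ} (hβ : β < n + 4) (k : Fin n → ℤ) :
    0 ≤ nonlocalSymbol δ β k := by
  have hn' : (1 : ℝ) ≤ n := by exact_mod_cast hn
  exact mul_nonneg (by positivity)
    (symbolSum_pos (by linarith) (by linarith) (by positivity)).le

theorem IsNonlocalLaplacian.coeff_eq {δ β : ℝ} {u w : PeriodicDistribution n}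
    (h : IsNonlocalLaplacian δ β u w) (k : Fin n → ℤ) :
    fourierCoeffDist w k = -(nonlocalSymbol δ β k : ℂ) * fourierCoeffDist u k := by
  rw [h k, nonlocalMultiplier_eq, Complex.ofReal_neg]

theorem exists_solvesForcedWave_nonlocal (hn : 1 ≤ n) {δ β σ : ℝ} (hβ : β < n + 4)
    {b : PeriodicDistribution n} (hb : MemSobolev σ b) :
    ∃ U, SolvesForcedWave (IsNonlocalLaplacian δ β) σ b U := by
  obtain ⟨A, P, hA, hP⟩ := hb.exists_polynomial_bound
  refine exists_solvesForcedWave hb (nonlocalSymbol_nonneg (δ := δ) hn hβ) fun u hu => ?_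
  obtain ⟨w, hw⟩ := exists_fourierCoeffDist_eq
    (fun k => -(nonlocalSymbol δ β k : ℂ) * fourierCoeffDist u k) (2 * A) P fun k => by
      rw [neg_mul, norm_neg, mul_assoc]
      exact (hu k).trans (by gcongr; exact hP k)
  exact ⟨w, fun k => by rw [hw, nonlocalMultiplier_eq, Complex.ofReal_neg], hw⟩

theorem exists_solvesForcedWave_classical {σ : ℝ} {b : PeriodicDistribution n}
    (hb : MemSobolev σ b) : ∃ U, SolvesForcedWave IsClassicalLaplacian σ b U := by
  refine exists_solvesForcedWave hb (lam := fun k => ‖latticeVec k‖ ^ 2)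
    (fun k => by positivity) fun u _ => ?_
  obtain ⟨w, hw⟩ := exists_isClassicalLaplacian u
  exact ⟨w, hw, hw.coeff_eq⟩

theorem memSobolev_of_waveKernel {σ r c R t : ℝ} (hc : 0 < c) (hR : 1 ≤ R) (hr : 0 ≤ r)
    {lam : (Fin n → ℤ) → ℝ} {u b : PeriodicDistribution n} (hb : MemSobolev σ b)
    (hu : ∀ k, fourierCoeffDist u k = waveKernel (lam k) t * fourierCoeffDist b k)
    (h : ∀ k, R ≤ ‖latticeVec k‖ ^ 2 → c * (‖latticeVec k‖ ^ 2) ^ r ≤ lam k) :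
    MemSobolev (σ + 2 * r) u := by
  refine hb.of_multiplier hu (C := (1 + R) ^ r * (t ^ 2 / 2) + 2 ^ r * (2 / c)) fun k => ?_
  rw [abs_of_nonneg (mul_nonneg (by positivity) (waveKernel_nonneg _ _))]
  exact rpow_mul_waveKernel_le hc hR hr (by positivity) (h k)

/-- Growth of the symbol: order `β - n` at infinity. -/
theorem exists_le_nonlocalSymbol (hn : 1 ≤ n) {δ β : ℝ} (hδ : 0 < δ) (hβ : β < n + 4) :
    ∃ c R, 0 < c ∧ 1 ≤ R ∧ ∀ k : Fin n → ℤ, R ≤ ‖latticeVec k‖ ^ 2 →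
      c * (‖latticeVec k‖ ^ 2) ^ ((β - n) / 2) ≤ nonlocalSymbol δ β k := by
  have hn' : (1 : ℝ) ≤ n := by exact_mod_cast hn
  set a := ((n : ℝ) + 2 - β) / 2 with ha
  obtain ⟨C, hC, h⟩ := exists_rpow_le_symbolSum (c := (n : ℝ) / 2) (a := a) (by linarith)
    (by linarith)
  set d := δ ^ 2 / 4 with hd
  have hd0 : 0 < d := by positivity
  refine ⟨C * d ^ (-a), max 1 d⁻¹, by positivity, le_max_left _ _, fun k hk => ?_⟩
  set x := ‖latticeVec k‖ ^ 2 with hx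
  have hx0 : 0 < x := one_pos.trans_le ((le_max_left _ _).trans hk)
  have h1 : 1 ≤ d * x := by
    have := (le_max_right _ _).trans hk
    rwa [inv_le_iff_one_le_mul₀' hd0] at this
  have h2 := h _ h1
  rw [Real.mul_rpow hd0.le hx0.le] at h2
  have h3 : x ^ ((β - n) / 2) = x * x ^ (-a) := by
    rw [show (β - n) / 2 = 1 + -a by rw [ha]; ring, Real.rpow_add hx0, Real.rpow_one]
  rw [h3]
  calc C * d ^ (-a) * (x * x ^ (-a)) = x * (C * (d ^ (-a) * x ^ (-a))) := by ring
    _ ≤ x * symbolSum (n / 2) a (d * x) := by gcongr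

/-- A lower bound for the symbol that is uniform for `β` near `n + 2`. -/
theorem eventually_le_nonlocalSymbol (hn : 1 ≤ n) {δ r : ℝ} (hδ : 0 < δ) (hr : r < 1) :
    ∃ c R, 0 < c ∧ 1 ≤ R ∧ ∀ᶠ β in 𝓝 ((n : ℝ) + 2), ∀ k : Fin n → ℤ,
      R ≤ ‖latticeVec k‖ ^ 2 → c * (‖latticeVec k‖ ^ 2) ^ r ≤ nonlocalSymbol δ β k := by
  have hn' : (1 : ℝ) ≤ n := by exact_mod_cast hn
  set d := δ ^ 2 / 4 with hd
  have hd0 : 0 < d := by positivity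
  have ht : Filter.Tendsto (fun β : ℝ => ((n : ℝ) + 2 - β) / 2) (𝓝 ((n : ℝ) + 2)) (𝓝 0) := by
    have : Continuous fun β : ℝ => ((n : ℝ) + 2 - β) / 2 := by fun_prop
    simpa using this.tendsto ((n : ℝ) + 2)
  -- Pointwise convergence at the single point `x = 1` suffices: for `a > 0` monotonicity of `xᵃ S`
  -- carries the bound `1/2` to all `x ≥ 1`.
  have e1 := ht.eventually ((tendsto_symbolSum (c := (n : ℝ) / 2) (by linarith) 1).eventually
    (lt_mem_nhds (show (1 / 2 : ℝ) < 1 by norm_num)))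
  have e2 := ht.eventually (Ioo_mem_nhds (show (-1 : ℝ) < 0 by norm_num)
    (show 0 < min 1 (1 - r) from lt_min one_pos (by linarith)))
  -- `max d 1` bounds `d ^ a` for `0 < a < 1`, and `x ≥ max 1 d⁻¹` ensures both `x ≥ 1` and `d * x ≥
  -- 1`.
  refine ⟨1 / 2 * (max d 1)⁻¹, max 1 d⁻¹, by positivity, le_max_left _ _, ?_⟩
  filter_upwards [e1, e2] with β h1 h2 k hk
  rw [nonlocalSymbol]
  set a := ((n : ℝ) + 2 - β) / 2 with ha
  set x := ‖latticeVec k‖ ^ 2 with hx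
  have hx1 : 1 ≤ x := (le_max_left _ _).trans hk
  have hx0 : 0 < x := one_pos.trans_le hx1
  have hdx : 1 ≤ d * x := by
    have := (le_max_right _ _).trans hk
    rwa [inv_le_iff_one_le_mul₀' hd0] at this
  have hm : (max d 1)⁻¹ ≤ 1 := inv_le_one_of_one_le₀ (le_max_right _ _)
  have hm0 : 0 < (max d 1)⁻¹ := by positivity
  rcases le_or_gt a 0 with ha0 | ha0
  · have h3 := one_le_symbolSum (c := (n : ℝ) / 2) (by linarith) h2.1 ha0 (x := d * x)
      (by positivity)
    have h4 : x ^ r ≤ x := by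
      simpa using Real.rpow_le_rpow_of_exponent_le hx1 hr.le
    calc 1 / 2 * (max d 1)⁻¹ * x ^ r ≤ 1 * x := by gcongr; linarith
      _ ≤ x * symbolSum (n / 2) a (d * x) := by nlinarith
  · have ha1 : a < 1 := h2.2.trans_le (min_le_left _ _)
    have har : a < 1 - r := h2.2.trans_le (min_le_right _ _)
    have h3 := rpow_mul_symbolSum_mono (c := (n : ℝ) / 2) (by linarith) ha0 one_pos hdx
    rw [Real.one_rpow, one_mul, Real.mul_rpow hd0.le hx0.le] at h3
    have h4 : d ^ a ≤ max d 1 := by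
      calc d ^ a ≤ (max d 1) ^ a := Real.rpow_le_rpow hd0.le (le_max_left _ _) ha0.le
        _ ≤ (max d 1) ^ (1 : ℝ) := Real.rpow_le_rpow_of_exponent_le (le_max_right _ _) ha1.le
        _ = _ := Real.rpow_one _
    -- The loss `x⁻ᵃ` in the symbol is absorbed by the gap `1 - r`; this is where `r < 1` pays for
    -- uniformity in `β`.
    have h5 : x ^ r * x ^ a ≤ x := by
      rw [← Real.rpow_add hx0]
      simpa using Real.rpow_le_rpow_of_exponent_le hx1 (show r + a ≤ 1 by linarith)
    have hs : 0 < symbolSum (n / 2) a (d * x) :=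
      symbolSum_pos (by linarith) (by linarith) (by positivity)
    have h6 : 1 / 2 ≤ max d 1 * x ^ a * symbolSum (n / 2) a (d * x) := by
      refine h1.le.trans (h3.trans ?_)
      gcongr
    have hM : 0 < max d 1 := by positivity
    calc 1 / 2 * (max d 1)⁻¹ * x ^ r
        ≤ (max d 1 * x ^ a * symbolSum (n / 2) a (d * x)) * (max d 1)⁻¹ * x ^ r := by gcongr
      _ = x ^ r * x ^ a * symbolSum (n / 2) a (d * x) := by field_simp
      _ ≤ _ := by gcongr

theorem tendsto_nonlocalSymbol (hn : 1 ≤ n) (δ : ℝ) (k : Fin n → ℤ) :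
    Filter.Tendsto (fun β => nonlocalSymbol δ β k) (𝓝 ((n : ℝ) + 2))
      (𝓝 (‖latticeVec k‖ ^ 2)) := by
  have hn' : (1 : ℝ) ≤ n := by exact_mod_cast hn
  have ht : Filter.Tendsto (fun β : ℝ => ((n : ℝ) + 2 - β) / 2) (𝓝 ((n : ℝ) + 2)) (𝓝 0) := by
    have : Continuous fun β : ℝ => ((n : ℝ) + 2 - β) / 2 := by fun_prop
    simpa using this.tendsto ((n : ℝ) + 2)
  have := ((tendsto_symbolSum (c := (n : ℝ) / 2) (by linarith)
    (δ ^ 2 / 4 * ‖latticeVec k‖ ^ 2)).comp ht).const_mul (‖latticeVec k‖ ^ 2)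
  rw [mul_one] at this
  exact this

end Wave

end

/-! ### The main theorem -/

theorem mainTheorem12 (n : ℕ) (hn : 1 ≤ n) (δ : ℝ) (hδ : 0 < δ) (σ : ℝ)
    (b : PeriodicDistribution n) (hb : MemSobolev σ b) :
    -- the nonlocal and the classical problems have solutions
    (∀ β : ℝ, β < n + 4 → ∃ U, SolvesForcedWave (IsNonlocalLaplacian δ β) σ b U) ∧
    (∃ U, SolvesForcedWave IsClassicalLaplacian σ b U) ∧
    -- whatever Sobolev spaces the solutions are taken in, they converge as `β → n + 2`
    ∀ (U : ℝ → ℝ → PeriodicDistribution n) (U₀ : ℝ → PeriodicDistribution n),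
      (∀ β : ℝ, β < n + 4 → ∃ q : ℝ, SolvesForcedWave (IsNonlocalLaplacian δ β) q b (U β)) →
      (∃ q : ℝ, SolvesForcedWave IsClassicalLaplacian q b U₀) →
      ∀ t : ℝ, 0 ≤ t →
        (∀ β : ℝ, β < n + 4 → MemSobolev (σ + max 0 (β - n)) (U β t)) ∧
        MemSobolev (σ + 2) (U₀ t) ∧
        ∀ ε : ℝ, 0 < ε → ε < 2 → ε < (n : ℝ) / 2 →
          (∀ᶠ β in 𝓝[≠] ((n : ℝ) + 2), MemSobolev (σ + 2 - ε) (U β t)) ∧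
          MemSobolev (σ + 2 - ε) (U₀ t) ∧
          Filter.Tendsto (fun β => sobolevNorm (σ + 2 - ε) (U β t - U₀ t))
            (𝓝[≠] ((n : ℝ) + 2)) (𝓝 0) := by
  refine ⟨fun β hβ => exists_solvesForcedWave_nonlocal hn hβ hb,
    exists_solvesForcedWave_classical hb, fun U U₀ hU hU₀ t ht => ?_⟩
  have hcU : ∀ β : ℝ, β < n + 4 → ∀ k, fourierCoeffDist (U β t) k =
      waveKernel (nonlocalSymbol δ β k) t * fourierCoeffDist b k := by
    intro β hβ k
    obtain ⟨q, hq⟩ := hU β hβ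
    exact hq.coeff_eq (nonlocalSymbol_nonneg hn hβ) (fun u w h => h.coeff_eq) ht k
  have hcU₀ : ∀ k, fourierCoeffDist (U₀ t) k =
      waveKernel (‖latticeVec k‖ ^ 2) t * fourierCoeffDist b k := by
    intro k
    obtain ⟨q, hq⟩ := hU₀
    exact hq.coeff_eq (lam := fun k => ‖latticeVec k‖ ^ 2) (fun k => by positivity)
      (fun u w h => h.coeff_eq) ht k
  have hclass : ∀ r : ℝ, r ≤ 1 → ∀ k : Fin n → ℤ, 1 ≤ ‖latticeVec k‖ ^ 2 →
      1 * (‖latticeVec k‖ ^ 2) ^ r ≤ ‖latticeVec k‖ ^ 2 := by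
    intro r hr k hk
    simpa using Real.rpow_le_rpow_of_exponent_le hk hr
  refine ⟨fun β hβ => ?_, ?_, fun ε hε hε2 _ => ?_⟩
  -- For `β ≤ n` the growth exponent `β - n` of the symbol bound yields no gain, and `w ≤ t² / 2`
  -- keeps the solution in `H^σ`.
  · rcases le_or_gt β n with hβn | hβn
    · rw [max_eq_left (by linarith), ← mul_zero 2]
      refine hb.of_multiplier (hcU β hβ) (C := t ^ 2 / 2) fun k => ?_
      rw [Real.rpow_zero, one_mul, abs_of_nonneg (waveKernel_nonneg _ _)]
      exact waveKernel_le _ _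
    · rw [max_eq_right (by linarith), show β - n = 2 * ((β - n) / 2) by ring]
      obtain ⟨c, R, hc, hR, h⟩ := exists_le_nonlocalSymbol hn hδ hβ
      exact memSobolev_of_waveKernel hc hR (by linarith) hb (hcU β hβ) h
  · rw [show σ + 2 = σ + 2 * 1 by ring]
    exact memSobolev_of_waveKernel one_pos le_rfl zero_le_one hb hcU₀
      (hclass 1 le_rfl)
  -- A weight of power `r` gains `2 r = 2 - ε` derivatives; `0 < ε` gives `r < 1` and `ε < 2` gives
  -- `r ≥ 0`.
  · set r := 1 - ε / 2 with hr
    have hr0 : 0 ≤ r := by linarith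
    have hσ : σ + 2 - ε = σ + 2 * r := by rw [hr]; ring
    obtain ⟨c, R, hc, hR, h⟩ := eventually_le_nonlocalSymbol hn hδ (show r < 1 by linarith)
    have h4 : ∀ᶠ β : ℝ in 𝓝 ((n : ℝ) + 2), β < n + 4 := gt_mem_nhds (by linarith)
    rw [hσ]
    refine ⟨nhdsWithin_le_nhds ?_, ?_, Filter.Tendsto.mono_left ?_ nhdsWithin_le_nhds⟩
    · filter_upwards [h, h4] with β hβ hβ4
      exact memSobolev_of_waveKernel hc hR hr0 hb (hcU β hβ4) hβ
    · exact memSobolev_of_waveKernel one_pos le_rfl hr0 hb hcU₀ (hclass r (by linarith))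
    -- The majorant adds the uniform nonlocal bound and the classical one, the latter with `c = R =
    -- 1`.
    · refine tendsto_sobolevNorm_of_multiplier (f := fun β k =>
        waveKernel (nonlocalSymbol δ β k) t - waveKernel (‖latticeVec k‖ ^ 2) t)
        (C := ((1 + R) ^ r * (t ^ 2 / 2) + 2 ^ r * (2 / c)) +
          ((1 + 1) ^ r * (t ^ 2 / 2) + 2 ^ r * (2 / 1))) hb ?_ ?_ fun k => ?_
      · filter_upwards [h4] with β hβ k
        rw [fourierCoeffDist_sub, hcU β hβ, hcU₀]
        push_cast
        ring
      · filter_upwards [h] with β hβ k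
        have hx : 0 ≤ ‖latticeVec k‖ ^ 2 := by positivity
        have hw : 0 ≤ (1 + ‖latticeVec k‖ ^ 2) ^ r := by positivity
        have h5 := rpow_mul_waveKernel_le (t := t) hc hR hr0 hx (hβ k)
        have h6 := rpow_mul_waveKernel_le (t := t) one_pos le_rfl hr0 hx
          (hclass r (by linarith) k)
        have h7 := mul_nonneg hw (waveKernel_nonneg (nonlocalSymbol δ β k) t)
        have h8 := mul_nonneg hw (waveKernel_nonneg (‖latticeVec k‖ ^ 2) t)
        rw [mul_sub, abs_le]
        constructor <;> linarith
      · rw [← sub_self (waveKernel (‖latticeVec k‖ ^ 2) t)]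
        exact ((continuous_waveKernel t).continuousAt.tendsto.comp
          (tendsto_nonlocalSymbol hn δ k)).sub_const _
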